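/- Let $\mathring{\mathfrak g}$ be a finite-dimensional simple complex Lie algebra with a Cartan subalgebra $\mathring{\mathfrak h}$, a choice of simple roots, the corresponding triangular decomposition $\mathring{\mathfrak g}=\mathring{\mathfrak n}_-\oplus\mathring{\mathfrak h}\oplus\mathring{\mathfrak n}_+$, and a non-degenerate symmetric invariant bilinear form $\langle\cdot,\cdot\rangle$. Let $\mathfrak g'=\mathring{\mathfrak g}\otimes\mathbb C[t,t^{-1}]\oplus\mathbb CK$, with $K$ central and $$[x\otimes t^n,y\otimes t^m]=[x,y]\otimes t^{n+m}+n\,\delta_{m,-n}\langle x,y\rangle K .$$ Let $\mathrm{Vir}$ be the Virasoro algebra with basis $\{d_n,C: n\in\mathbb Z\}$, $C$ central and $[d_n,d_m]=(m-n)d_{n+m}+\delta_{m,-n}\frac{n^3-n}{12}C$. Let $\mathfrak L=\mathfrak g'\rtimes\mathrm{Vir}$, where $[d_n,x\otimes t^m]=m\,x\otimes t^{m+n}$, $[d_n,K]=0$ and $[C,\mathfrak g']=0$. For a finitely generated commutative associative unital $\mathbb C$-algebra $A$ let $\mathfrak L(A)=\mathfrak L\otimes A$ with $[X\otimes a,Y\otimes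 b]=[X,Y]\otimes ab$. Identify $X\in\mathfrak L$ with $X\otimes 1$, and put $\bar{\mathfrak h}=\mathring{\mathfrak h}\oplus\mathbb CK\oplus\mathbb Cd_0\oplus\mathbb CC$. For $\lambda\in\bar{\mathfrak h}^*$ let $V_\lambda=\{v\in V: hv=\lambda(h)v\ \ \forall h\in\bar{\mathfrak h}\}$. An $\mathfrak L(A)$-module $V$ is a *weight module* if $V=\bigoplus_{\lambda\in\bar{\mathfrak h}^*}V_\lambda$. It is *integrable* if it is a weight module, every $V_\lambda$ is finite-dimensional, and $(x\otimes t^n)\otimes a$ acts locally nilpotently on $V$ for every root $\alpha$ of $\mathring{\mathfrak g}$, $x\in\mathring{\mathfrak g}_\alpha$, $n\in\mathbb Z$ and $a\in A$. Let $$\mathfrak L(A)^{\pm}=\Big(\mathring{\mathfrak n}_\pm\oplus\bigoplus_{n>0}\mathring{\mathfrak g}\otimes t^{\pm n}\oplus\bigoplus_{n>0}\mathbb Cd_{\pm n}\Big)\otimes A .$$ A *highest* (resp. *lowest*) *weight module* of highest (resp. lowest) weight $\lambda$ is a weight module $V$ with a vector $0\ne v\in V_\lambda$ such that $\mathfrak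 L(A)^+v=0$ (resp. $\mathfrak L(A)^-v=0$) and $U(\mathfrak L(A))v=V$. **Proposition.** Let $V$ be an irreducible integrable $\mathfrak L(A)$-module on which $K$ acts non-trivially. Then $V$ is a highest weight module or a lowest weight module, for some highest (resp. lowest) weight $\lambda$ with $\dim V_\lambda=1$. Moreover, if $\langle\cdot,\cdot\rangle$ is normalized so that the highest root $\theta$ of $\mathring{\mathfrak g}$ satisfies $\langle\theta,\theta\rangle=2$, then $K$ acts on $V$ by a nonzero integer $m$. In that case, if $m>0$ then $V$ is a highest weight module of some highest weight $\lambda$ with $\dim V_\lambda=1$, and if $m<0$ then $V$ is a lowest weight module of some lowest weight $\lambda$ with $\dim V_\lambda=1$. -/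

import Mathlib

open scoped TensorProduct

noncomputable section

namespace LoopAffVir

/-! ### The Virasoro algebra -/

/-- The Virasoro algebra `Vir`: the vector space with basis `d n` (`n : ℤ`) and `C`. -/
def Vir : Type := (ℤ →₀ ℂ) × ℂ

namespace Vir

instance : AddCommGroup Vir := inferInstanceAs (AddCommGroup ((ℤ →₀ ℂ) × ℂ))

instance : Module ℂ Vir := inferInstanceAs (Module ℂ ((ℤ →₀ ℂ) × ℂ))

/-- The bilinear map with `(d n, d m) ↦ (m - n) d (n + m)`. -/
def wittBracket : (ℤ →₀ ℂ) →ₗ[ℂ] (ℤ →₀ ℂ) →ₗ[ℂ] (ℤ →₀ ℂ) :=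
  Finsupp.linearCombination ℂ fun n : ℤ =>
    Finsupp.linearCombination ℂ fun m : ℤ => Finsupp.single (n + m) ((m : ℂ) - n)

/-- The bilinear map with `(d n, d m) ↦ δ_{m,-n} (n³ - n) / 12`. -/
def cocycle : (ℤ →₀ ℂ) →ₗ[ℂ] (ℤ →₀ ℂ) →ₗ[ℂ] ℂ :=
  Finsupp.linearCombination ℂ fun n : ℤ =>
    Finsupp.linearCombination ℂ fun m : ℤ => if m = -n then ((n : ℂ) ^ 3 - n) / 12 else 0

@[simp] lemma wittBracket_single (n m : ℤ) (a b : ℂ) :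
    wittBracket (Finsupp.single n a) (Finsupp.single m b) =
      Finsupp.single (n + m) (a * b * ((m : ℂ) - n)) := by
  simp only [wittBracket, Finsupp.linearCombination_single, LinearMap.smul_apply,
    Finsupp.smul_single, smul_eq_mul, mul_assoc]

@[simp] lemma cocycle_single (n m : ℤ) (a b : ℂ) :
    cocycle (Finsupp.single n a) (Finsupp.single m b) =
      if m = -n then a * b * (((n : ℂ) ^ 3 - n) / 12) else 0 := by
  simp [cocycle, mul_assoc]

lemma wittBracket_skew (x y : ℤ →₀ ℂ) : wittBracket x y = -wittBracket y x := by
  induction x using Finsupp.induction_linear with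
  | zero => simp
  | add f g hf hg => simp only [map_add, LinearMap.add_apply, hf, hg]; abel
  | single n a =>
    induction y using Finsupp.induction_linear with
    | zero => simp
    | add f g hf hg => simp only [map_add, LinearMap.add_apply, hf, hg]; abel
    | single m b =>
      rw [wittBracket_single, wittBracket_single, add_comm m n, ← Finsupp.single_neg]
      congr 1
      ring

lemma cocycle_skew (x y : ℤ →₀ ℂ) : cocycle x y = -cocycle y x := by
  induction x using Finsupp.induction_linear with
  | zero => simp
  | add f g hf hg => simp only [map_add, LinearMap.add_apply, hf, hg]; abel
  | single n a =>
    induction y using Finsupp.induction_linear with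
    | zero => simp
    | add f g hf hg => simp only [map_add, LinearMap.add_apply, hf, hg]; abel
    | single m b =>
      rw [cocycle_single, cocycle_single]
      by_cases h : m = -n
      · subst h
        simp
        ring
      · rw [if_neg h, if_neg (by omega), neg_zero]

lemma wittBracket_leibniz (x y z : ℤ →₀ ℂ) :
    wittBracket x (wittBracket y z) =
      wittBracket (wittBracket x y) z + wittBracket y (wittBracket x z) := by
  induction x using Finsupp.induction_linear with
  | zero => simp
  | add f g hf hg => simp only [map_add, LinearMap.add_apply, hf, hg]; abel
  | single n a =>
    induction y using Finsupp.induction_linear with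
    | zero => simp
    | add f g hf hg => simp only [map_add, LinearMap.add_apply, hf, hg]; abel
    | single m b =>
      induction z using Finsupp.induction_linear with
      | zero => simp
      | add f g hf hg => simp only [map_add, hf, hg]; abel
      | single k c =>
        simp only [wittBracket_single]
        rw [show n + m + k = n + (m + k) by ring, show m + (n + k) = n + (m + k) by ring,
          ← Finsupp.single_add]
        congr 1
        push_cast
        ring

lemma cocycle_leibniz (x y z : ℤ →₀ ℂ) :
    cocycle x (wittBracket y z) =
      cocycle (wittBracket x y) z + cocycle y (wittBracket x z) := by
  induction x using Finsupp.induction_linear with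
  | zero => simp
  | add f g hf hg => simp only [map_add, LinearMap.add_apply, hf, hg]; abel
  | single n a =>
    induction y using Finsupp.induction_linear with
    | zero => simp
    | add f g hf hg => simp only [map_add, LinearMap.add_apply, hf, hg]; abel
    | single m b =>
      induction z using Finsupp.induction_linear with
      | zero => simp
      | add f g hf hg => simp only [map_add, hf, hg]; abel
      | single k c =>
        simp only [wittBracket_single, cocycle_single]
        by_cases h : m + k = -n
        · obtain rfl : k = -n - m := by omega
          rw [if_pos h, if_pos (by omega), if_pos (by omega)]
          push_cast
          ring
        · rw [if_neg h, if_neg (by omega), if_neg (by omega), add_zero]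

instance : LieRing Vir where
  bracket x y := (wittBracket x.1 y.1, cocycle x.1 y.1)
  add_lie x y z := by
    change ((_, _) : (ℤ →₀ ℂ) × ℂ) = (_ + _, _ + _)
    exact Prod.ext (by simp [show (x + y).1 = x.1 + y.1 from rfl])
      (by simp [show (x + y).1 = x.1 + y.1 from rfl])
  lie_add x y z := by
    change ((_, _) : (ℤ →₀ ℂ) × ℂ) = (_ + _, _ + _)
    exact Prod.ext (by simp [show (y + z).1 = y.1 + z.1 from rfl])
      (by simp [show (y + z).1 = y.1 + z.1 from rfl])
  lie_self x := Prod.ext (self_eq_neg.mp (wittBracket_skew x.1 x.1))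
    (self_eq_neg.mp (cocycle_skew x.1 x.1))
  leibniz_lie x y z := Prod.ext (wittBracket_leibniz x.1 y.1 z.1) (cocycle_leibniz x.1 y.1 z.1)

instance : LieAlgebra ℂ Vir where
  lie_smul t x y := Prod.ext (map_smul (wittBracket x.1) t y.1) (map_smul (cocycle x.1) t y.1)

/-- The identification of `(ℤ →₀ ℂ) × ℂ` with `Vir`. -/
def ofPair : ((ℤ →₀ ℂ) × ℂ) →ₗ[ℂ] Vir := LinearMap.id

/-- The basis element `d n`. -/
def d (n : ℤ) : Vir := ofPair (Finsupp.single n 1, 0)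

/-- The central element `C`. -/
def C : Vir := ofPair (0, 1)

theorem lie_d_d (n m : ℤ) :
    ⁅d n, d m⁆ = ((m : ℂ) - n) • d (n + m) +
      (if m = -n then ((n : ℂ) ^ 3 - n) / 12 else 0) • C := by
  refine Prod.ext ?_ ?_
  · change wittBracket (Finsupp.single n 1) (Finsupp.single m 1) =
      ((m : ℂ) - n) • Finsupp.single (n + m) (1 : ℂ) + _ • (0 : ℤ →₀ ℂ)
    simp
  · change cocycle (Finsupp.single n 1) (Finsupp.single m 1) =
      ((m : ℂ) - n) • (0 : ℂ) + (if m = -n then ((n : ℂ) ^ 3 - n) / 12 else 0) • (1 : ℂ)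
    simp

theorem lie_C (x : Vir) : ⁅C, x⁆ = 0 :=
  Prod.ext (by change wittBracket 0 x.1 = 0; simp) (by change cocycle 0 x.1 = 0; simp)

end Vir

/-! ### The derived affine algebra and its semidirect product with `Vir` -/

/-- An invariant symmetric non-degenerate bilinear form `⟨·,·⟩` on a complex Lie algebra. -/
structure InvForm (𝔤 : Type*) [LieRing 𝔤] [LieAlgebra ℂ 𝔤] where
  form : LinearMap.BilinForm ℂ 𝔤
  invariant : form.lieInvariant 𝔤
  symm : form.IsSymm
  nondegenerate : form.Nondegenerate

variable {𝔤 : Type*} [LieRing 𝔤] [LieAlgebra ℂ 𝔤]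

open LieAlgebra

/-- The cocycle `(x ⊗ tⁿ, y ⊗ tᵐ) ↦ n δ_{m,-n} ⟨x, y⟩` on `𝔤 ⊗ ℂ[t, t⁻¹]`. -/
def affCocycle (Φ : InvForm 𝔤) : LieModule.Cohomology.twoCocycle ℂ (loopAlgebra ℂ ℤ 𝔤)
    (TrivialLieModule ℂ (loopAlgebra ℂ ℤ 𝔤) ℂ) :=
  LoopAlgebra.twoCocycleOfBilinear ℂ ℤ 𝔤 (-Φ.form)
    (fun x y z => by simp [Φ.invariant x y z]) ⟨fun x y => by simp [Φ.symm.eq x y]⟩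

/-- The Lie algebra `𝔤' = 𝔤 ⊗ ℂ[t, t⁻¹] ⊕ ℂ K`. -/
abbrev Aff (Φ : InvForm 𝔤) : Type _ := LieAlgebra.ofTwoCocycle (affCocycle Φ)

/-- `x ⊗ tⁿ` in the loop algebra. -/
def loopElt (x : 𝔤) (n : ℤ) : loopAlgebra ℂ ℤ 𝔤 := AddMonoidAlgebra.single n (1 : ℂ) ⊗ₜ[ℂ] x

lemma loop_induction {p : loopAlgebra ℂ ℤ 𝔤 → Prop} (z : loopAlgebra ℂ ℤ 𝔤) (h0 : p 0)
    (hadd : ∀ u v, p u → p v → p (u + v)) (hs : ∀ (x : 𝔤) n, p (loopElt x n)) : p z := by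
  obtain ⟨f, rfl⟩ := (LoopAlgebra.toFinsupp ℂ ℤ 𝔤).symm.surjective z
  induction f using Finsupp.induction_linear with
  | zero => simpa using h0
  | add f g hf hg => rw [map_add]; exact hadd _ _ hf hg
  | single n x => rw [LoopAlgebra.toFinsupp_symm_single]; exact hs x n

/-- The Lie bracket of the loop algebra as a bilinear map. -/
def loopBr : loopAlgebra ℂ ℤ 𝔤 →ₗ[ℂ] loopAlgebra ℂ ℤ 𝔤 →ₗ[ℂ] loopAlgebra ℂ ℤ 𝔤 :=
  (LieAlgebra.ad ℂ (loopAlgebra ℂ ℤ 𝔤) : loopAlgebra ℂ ℤ 𝔤 →ₗ[ℂ] _)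

lemma loopBr_loopElt (x y : 𝔤) (n m : ℤ) :
    loopBr (loopElt x n) (loopElt y m) = loopElt ⁅x, y⁆ (n + m) := by
  change (AddMonoidAlgebra.single n (1 : ℂ) * AddMonoidAlgebra.single m (1 : ℂ)) ⊗ₜ[ℂ] ⁅x, y⁆ = _
  rw [AddMonoidAlgebra.single_mul_single, one_mul, loopElt]

lemma affCocycle_loopElt (Φ : InvForm 𝔤) (x y : 𝔤) (n m : ℤ) :
    (affCocycle Φ : loopAlgebra ℂ ℤ 𝔤 →ₗ[ℂ] loopAlgebra ℂ ℤ 𝔤 →ₗ[ℂ]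
      TrivialLieModule ℂ (loopAlgebra ℂ ℤ 𝔤) ℂ) (loopElt x n) (loopElt y m) =
      (TrivialLieModule.equiv ℂ (loopAlgebra ℂ ℤ 𝔤) ℂ).symm
        (if m = -n then (n : ℂ) * Φ.form x y else 0) := by
  change LoopAlgebra.residuePairing ℂ ℤ 𝔤 (-Φ.form) (loopElt x n) (loopElt y m) = _
  rw [LoopAlgebra.residuePairing_apply_apply, loopElt, loopElt,
    LoopAlgebra.toFinsupp_single_tmul, LoopAlgebra.toFinsupp_single_tmul,
    Finsupp.sum_single_index (by simp)]
  by_cases h : m = -n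
  · subst h
    simp
    rfl
  · rw [if_neg h, Finsupp.single_eq_of_ne (by omega)]
    simp
    rfl

/-- The linear map `tᵐ ↦ m tᵐ⁺ⁿ`, that is `tⁿ⁺¹ d/dt`, depending linearly on `n : ℤ →₀ ℂ`. -/
def laurentDer : (ℤ →₀ ℂ) →ₗ[ℂ] AddMonoidAlgebra ℂ ℤ →ₗ[ℂ] AddMonoidAlgebra ℂ ℤ :=
  Finsupp.linearCombination ℂ fun n : ℤ =>
    (AddMonoidAlgebra.basis ℤ ℂ).constr ℂ fun m : ℤ => (m : ℂ) • AddMonoidAlgebra.single (m + n) 1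

/-- The action of `∑ fₙ d n` on the loop algebra, `d n · (x ⊗ tᵐ) = m x ⊗ tᵐ⁺ⁿ`. -/
def loopDer : (ℤ →₀ ℂ) →ₗ[ℂ] loopAlgebra ℂ ℤ 𝔤 →ₗ[ℂ] loopAlgebra ℂ ℤ 𝔤 :=
  (LinearMap.rTensorHom 𝔤).comp laurentDer

lemma loopDer_loopElt (x : 𝔤) (n m : ℤ) (a : ℂ) :
    loopDer (Finsupp.single n a) (loopElt x m) = (a * m) • loopElt x (m + n) := by
  have h : laurentDer (Finsupp.single n a) (AddMonoidAlgebra.single m 1) =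
      (a * m) • AddMonoidAlgebra.single (m + n) (1 : ℂ) := by
    rw [laurentDer, Finsupp.linearCombination_single, LinearMap.smul_apply,
      ← AddMonoidAlgebra.basis_apply, Module.Basis.constr_basis, smul_smul]
  change LinearMap.rTensor 𝔤 _ (_ ⊗ₜ x) = _
  rw [LinearMap.rTensor_tmul, h]
  rfl

lemma loopDer_loopBr (f : ℤ →₀ ℂ) (u v : loopAlgebra ℂ ℤ 𝔤) :
    loopDer f (loopBr u v) = loopBr (loopDer f u) v + loopBr u (loopDer f v) := by
  induction f using Finsupp.induction_linear with
  | zero => simp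
  | add f g hf hg => simp only [map_add, LinearMap.add_apply, hf, hg]; abel
  | single n a =>
    induction u using loop_induction with
    | h0 => simp
    | hadd u u' hu hu' => simp only [map_add, LinearMap.add_apply, hu, hu']; abel
    | hs x p =>
      induction v using loop_induction with
      | h0 => simp
      | hadd v v' hv hv' => simp only [map_add, hv, hv']; abel
      | hs y q =>
        rw [loopBr_loopElt, loopDer_loopElt, loopDer_loopElt, loopDer_loopElt, map_smul, map_smul,
          LinearMap.smul_apply, loopBr_loopElt, loopBr_loopElt,
          show p + n + q = p + q + n by ring, ← add_assoc, ← add_smul]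
        congr 1
        push_cast
        ring

lemma loopDer_affCocycle (Φ : InvForm 𝔤) (f : ℤ →₀ ℂ) (u v : loopAlgebra ℂ ℤ 𝔤) :
    (affCocycle Φ : loopAlgebra ℂ ℤ 𝔤 →ₗ[ℂ] loopAlgebra ℂ ℤ 𝔤 →ₗ[ℂ]
      TrivialLieModule ℂ (loopAlgebra ℂ ℤ 𝔤) ℂ) (loopDer f u) v +
    (affCocycle Φ : loopAlgebra ℂ ℤ 𝔤 →ₗ[ℂ] loopAlgebra ℂ ℤ 𝔤 →ₗ[ℂ]
      TrivialLieModule ℂ (loopAlgebra ℂ ℤ 𝔤) ℂ) u (loopDer f v) = 0 := by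
  generalize hB : (affCocycle Φ : loopAlgebra ℂ ℤ 𝔤 →ₗ[ℂ] loopAlgebra ℂ ℤ 𝔤 →ₗ[ℂ]
      TrivialLieModule ℂ (loopAlgebra ℂ ℤ 𝔤) ℂ) = B
  induction f using Finsupp.induction_linear with
  | zero => simp
  | add f g hf hg =>
    simp only [map_add, LinearMap.add_apply]
    rw [add_add_add_comm, hf, hg, add_zero]
  | single n a =>
    induction u using loop_induction with
    | h0 => simp
    | hadd u u' hu hu' =>
      simp only [map_add, LinearMap.add_apply]
      rw [add_add_add_comm, hu, hu', add_zero]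
    | hs x p =>
      induction v using loop_induction with
      | h0 => simp
      | hadd v v' hv hv' =>
        simp only [map_add]
        rw [add_add_add_comm, hv, hv', add_zero]
      | hs y q =>
        rw [loopDer_loopElt, loopDer_loopElt, map_smul, map_smul, LinearMap.smul_apply, ← hB,
          affCocycle_loopElt, affCocycle_loopElt, ← map_smul, ← map_smul, ← map_add]
        by_cases h : q = -(p + n)
        · subst h
          rw [if_pos rfl, if_pos (by ring), LinearEquiv.map_eq_zero_iff]
          simp only [smul_eq_mul]
          push_cast
          ring
        · rw [if_neg h, if_neg (by omega), smul_zero, smul_zero, add_zero, map_zero]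

lemma loopDer_comm (f g : ℤ →₀ ℂ) (u : loopAlgebra ℂ ℤ 𝔤) :
    loopDer (Vir.wittBracket f g) u = loopDer f (loopDer g u) - loopDer g (loopDer f u) := by
  induction f using Finsupp.induction_linear with
  | zero => simp
  | add f f' hf hf' => simp only [map_add, LinearMap.add_apply, hf, hf']; abel
  | single n a =>
    induction g using Finsupp.induction_linear with
    | zero => simp
    | add f f' hf hf' => simp only [map_add, LinearMap.add_apply, hf, hf']; abel
    | single m b =>
      induction u using loop_induction with
      | h0 => simp
      | hadd u u' hu hu' => simp only [map_add, hu, hu']; abel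
      | hs x p =>
        rw [Vir.wittBracket_single]
        simp only [loopDer_loopElt, map_smul, smul_smul]
        rw [show p + m + n = p + (n + m) by ring, show p + n + m = p + (n + m) by ring, ← sub_smul]
        congr 1
        push_cast
        ring

lemma Aff.lie_def (Φ : InvForm 𝔤) (y z : Aff Φ) : ⁅y, z⁆ =
    ofProd (affCocycle Φ) (loopBr y.carrier.1 z.carrier.1,
      (affCocycle Φ : loopAlgebra ℂ ℤ 𝔤 →ₗ[ℂ] loopAlgebra ℂ ℤ 𝔤 →ₗ[ℂ]
        TrivialLieModule ℂ (loopAlgebra ℂ ℤ 𝔤) ℂ) y.carrier.1 z.carrier.1) := by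
  rw [bracket_ofTwoCocycle]
  refine congrArg _ (Prod.ext rfl ?_)
  exact (sub_zero _).trans (add_zero _)

/-- The derivation of `𝔤'` given by `d n · (x ⊗ tᵐ) = m x ⊗ tᵐ⁺ⁿ` and `d n · K = 0`. -/
def affDer (Φ : InvForm 𝔤) (f : ℤ →₀ ℂ) : LieDerivation ℂ (Aff Φ) (Aff Φ) where
  toFun z := ofProd (affCocycle Φ) (loopDer f z.carrier.1, 0)
  map_add' y z := by
    rw [← of_add, Prod.mk_add_mk, add_zero, ← map_add]
    rfl
  map_smul' t z := by
    rw [RingHom.id_apply, ← of_smul, Prod.smul_mk, smul_zero, ← map_smul]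
    rfl
  leibniz' y z := by
    change ofProd (affCocycle Φ) (_, 0) =
      ⁅y, ofProd (affCocycle Φ) (loopDer f z.carrier.1, 0)⁆ -
        ⁅z, ofProd (affCocycle Φ) (loopDer f y.carrier.1, 0)⁆
    rw [← lie_skew z, sub_neg_eq_add, Aff.lie_def, Aff.lie_def, Aff.lie_def, ← of_add,
      Prod.mk_add_mk]
    refine congrArg _ (Prod.ext ?_ ?_)
    · exact (loopDer_loopBr f _ _).trans (add_comm _ _)
    · exact ((add_comm _ _).trans (loopDer_affCocycle Φ f _ _)).symm

/-- The homomorphism `Vir → Der 𝔤'`; the element `C` acts by zero. -/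
def virAct (Φ : InvForm 𝔤) : Vir →ₗ⁅ℂ⁆ LieDerivation ℂ (Aff Φ) (Aff Φ) where
  toFun z := affDer Φ z.1
  map_add' y z := by
    ext w
    change ofProd (affCocycle Φ) (loopDer (y.1 + z.1) w.carrier.1, 0) =
      ofProd (affCocycle Φ) (_, 0) + ofProd (affCocycle Φ) (_, 0)
    rw [← of_add, Prod.mk_add_mk, add_zero, map_add]
    rfl
  map_smul' t z := by
    ext w
    change ofProd (affCocycle Φ) (loopDer (t • z.1) w.carrier.1, 0) =
      t • ofProd (affCocycle Φ) (_, 0)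
    rw [← of_smul, Prod.smul_mk, smul_zero, map_smul]
    rfl
  map_lie' {y z} := by
    ext w
    rw [LieDerivation.lie_apply]
    change ofProd (affCocycle Φ) (loopDer (Vir.wittBracket y.1 z.1) w.carrier.1, 0) =
      ofProd (affCocycle Φ) (loopDer y.1 (loopDer z.1 w.carrier.1), 0) -
        ofProd (affCocycle Φ) (loopDer z.1 (loopDer y.1 w.carrier.1), 0)
    rw [eq_sub_iff_add_eq, ← of_add, Prod.mk_add_mk, add_zero, loopDer_comm, sub_add_cancel]

/-- The affine-Virasoro algebra `𝔏 = 𝔤' ⋊ Vir`. -/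
abbrev AffVir (Φ : InvForm 𝔤) : Type _ := Aff Φ ⋊⁅virAct Φ⁆ Vir

namespace AffVir

variable (Φ : InvForm 𝔤)

/-- The element `x ⊗ tⁿ` of `𝔏`, as a linear function of `x`. -/
def x (n : ℤ) : 𝔤 →ₗ[ℂ] AffVir Φ where
  toFun y := SemiDirectSum.inl (virAct Φ) (ofProd (affCocycle Φ) (loopElt y n, 0))
  map_add' y z := by
    rw [← map_add, ← of_add, Prod.mk_add_mk, add_zero, loopElt, TensorProduct.tmul_add]
    rfl
  map_smul' t y := by
    rw [RingHom.id_apply, ← map_smul, ← of_smul, Prod.smul_mk, smul_zero, loopElt,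
      TensorProduct.tmul_smul]
    rfl

/-- The central element `K` of `𝔏`. -/
def K : AffVir Φ := SemiDirectSum.inl (virAct Φ) (ofProd (affCocycle Φ)
  (0, (TrivialLieModule.equiv ℂ (loopAlgebra ℂ ℤ 𝔤) ℂ).symm 1))

/-- The element `d n` of `𝔏`. -/
def d (n : ℤ) : AffVir Φ := SemiDirectSum.inr (virAct Φ) (Vir.d n)

/-- The Virasoro central element `C` of `𝔏`. -/
def C : AffVir Φ := SemiDirectSum.inr (virAct Φ) Vir.C

theorem lie_x_x (n m : ℤ) (y z : 𝔤) :
    ⁅x Φ n y, x Φ m z⁆ = x Φ (n + m) ⁅y, z⁆ +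
      (if m = -n then (n : ℂ) * Φ.form y z else 0) • K Φ := by
  change ⁅SemiDirectSum.inl (virAct Φ) _, SemiDirectSum.inl (virAct Φ) _⁆ =
    SemiDirectSum.inl (virAct Φ) _ + _ • SemiDirectSum.inl (virAct Φ) _
  rw [← LieHom.map_lie, ← map_smul, ← map_add, Aff.lie_def, ← of_smul, ← of_add]
  refine congrArg _ (congrArg _ (Prod.ext ?_ ?_))
  · refine (loopBr_loopElt y z n m).trans ?_
    rw [Prod.fst_add, Prod.smul_fst, smul_zero, add_zero]
  · refine (affCocycle_loopElt Φ y z n m).trans ?_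
    rw [Prod.snd_add, zero_add, Prod.smul_snd, ← map_smul, smul_eq_mul, mul_one]

theorem lie_d_x (n m : ℤ) (y : 𝔤) : ⁅d Φ n, x Φ m y⁆ = (m : ℂ) • x Φ (m + n) y := by
  rw [← map_smul]
  refine SemiDirectSum.ext ?_ ?_
  · change ⁅(0 : Aff Φ), _⁆ + ofProd (affCocycle Φ) (loopDer (Finsupp.single n 1) (loopElt y m), 0) -
      virAct Φ 0 0 = ofProd (affCocycle Φ) (loopElt ((m : ℂ) • y) (m + n), 0)
    rw [zero_lie, zero_add, map_zero, sub_zero, loopDer_loopElt, one_mul, loopElt, loopElt,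
      TensorProduct.tmul_smul]
  · exact lie_zero _

theorem lie_d_d (n m : ℤ) :
    ⁅d Φ n, d Φ m⁆ = ((m : ℂ) - n) • d Φ (n + m) +
      (if m = -n then ((n : ℂ) ^ 3 - n) / 12 else 0) • C Φ := by
  rw [d, d, d, C, ← LieHom.map_lie, Vir.lie_d_d, map_add, map_smul, map_smul]

theorem lie_K (z : AffVir Φ) : ⁅K Φ, z⁆ = 0 := by
  refine SemiDirectSum.ext ?_ (zero_lie _)
  change ⁅ofProd (affCocycle Φ) (0, _), z.left⁆ + virAct Φ 0 z.left -
    ofProd (affCocycle Φ) (loopDer z.right.1 0, 0) = 0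
  rw [Aff.lie_def, map_zero, map_zero]
  change ofProd (affCocycle Φ) (loopBr 0 _, _) + 0 - 0 = 0
  rw [add_zero, sub_zero, map_zero]
  refine congrArg (ofProd (affCocycle Φ)) (Prod.ext rfl ?_)
  exact LinearMap.congr_fun (map_zero _) _

theorem lie_C (z : AffVir Φ) : ⁅C Φ, z⁆ = 0 := by
  refine SemiDirectSum.ext ?_ (Vir.lie_C _)
  change ⁅(0 : Aff Φ), z.left⁆ + ofProd (affCocycle Φ) (loopDer 0 _, 0) - virAct Φ z.right 0 = 0
  rw [zero_lie, map_zero, map_zero, LinearMap.zero_apply, zero_add, sub_zero]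
  rfl

theorem span_eq_top : Submodule.span ℂ
    ({z | ∃ n y, z = x Φ n y} ∪ {z | ∃ n, z = d Φ n} ∪ {K Φ, C Φ}) = ⊤ := by
  set S := Submodule.span ℂ
    ({z | ∃ n y, z = x Φ n y} ∪ {z | ∃ n, z = d Φ n} ∪ {K Φ, C Φ}) with hS
  refine eq_top_iff.mpr fun z _ => ?_
  have h1 : ∀ u : loopAlgebra ℂ ℤ 𝔤,
      SemiDirectSum.inl (virAct Φ) (ofProd (affCocycle Φ) (u, 0)) ∈ S := by
    intro u
    induction u using loop_induction with
    | h0 => exact S.zero_mem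
    | hadd u v hu hv =>
      have := S.add_mem hu hv
      rwa [← map_add, ← of_add, Prod.mk_add_mk, add_zero] at this
    | hs y n => exact Submodule.subset_span (Or.inl (Or.inl ⟨n, y, rfl⟩))
  have h2 : ∀ k : ℂ, SemiDirectSum.inl (virAct Φ) (ofProd (affCocycle Φ)
      (0, (TrivialLieModule.equiv ℂ (loopAlgebra ℂ ℤ 𝔤) ℂ).symm k)) ∈ S := by
    intro k
    have := S.smul_mem k (Submodule.subset_span (Or.inr (Or.inl rfl)) : K Φ ∈ S)
    rwa [K, ← map_smul, ← of_smul, Prod.smul_mk, smul_zero, ← map_smul, smul_eq_mul,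
      mul_one] at this
  have h3 : ∀ f : ℤ →₀ ℂ, SemiDirectSum.inr (virAct Φ) (Vir.ofPair (f, 0)) ∈ S := by
    intro f
    induction f using Finsupp.induction_linear with
    | zero => exact S.zero_mem
    | add f g hf hg =>
      have := S.add_mem hf hg
      rwa [← map_add, ← map_add, Prod.mk_add_mk, add_zero] at this
    | single n a =>
      have := S.smul_mem a (Submodule.subset_span (Or.inl (Or.inr ⟨n, rfl⟩)) : d Φ n ∈ S)
      rwa [d, Vir.d, ← map_smul, ← map_smul, Prod.smul_mk, smul_zero, Finsupp.smul_single,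
        smul_eq_mul, mul_one] at this
  have h4 : ∀ c : ℂ, SemiDirectSum.inr (virAct Φ) (Vir.ofPair (0, c)) ∈ S := by
    intro c
    have := S.smul_mem c (Submodule.subset_span (Or.inr (Or.inr rfl)) : C Φ ∈ S)
    rwa [C, Vir.C, ← map_smul, ← map_smul, Prod.smul_mk, smul_zero, smul_eq_mul, mul_one] at this
  obtain ⟨⟨u, k⟩, f, c⟩ := z
  obtain ⟨k, rfl⟩ := (TrivialLieModule.equiv ℂ (loopAlgebra ℂ ℤ 𝔤) ℂ).symm.surjective k
  have := S.add_mem (S.add_mem (h1 u) (h2 k)) (S.add_mem (h3 f) (h4 c))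
  rw [← map_add, ← of_add, ← map_add, ← map_add, Prod.mk_add_mk, Prod.mk_add_mk, zero_add,
    zero_add, add_zero, add_zero] at this
  convert this using 1
  refine SemiDirectSum.ext ?_ ?_
  · exact (add_zero (ofProd (affCocycle Φ) _)).symm
  · exact (zero_add (Vir.ofPair (f, c))).symm

end AffVir

/-! ### The loop algebra of the affine-Virasoro algebra -/

/-- The loop affine-Virasoro algebra `𝔏(A) = 𝔏 ⊗ A`, with `[X ⊗ a, Y ⊗ b] = [X, Y] ⊗ ab`. -/
def LA (A : Type*) [CommRing A] [Algebra ℂ A] (Φ : InvForm 𝔤) : Type _ := A ⊗[ℂ] AffVir Φ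

namespace LA

variable (A : Type*) [CommRing A] [Algebra ℂ A] (Φ : InvForm 𝔤)

instance : LieRing (LA A Φ) := inferInstanceAs (LieRing (A ⊗[ℂ] AffVir Φ))

instance : LieAlgebra ℂ (LA A Φ) := inferInstanceAs (LieAlgebra ℂ (A ⊗[ℂ] AffVir Φ))

variable {A Φ}

/-- The element `X ⊗ a` of `𝔏(A)`, as a bilinear function. -/
def tmul : AffVir Φ →ₗ[ℂ] A →ₗ[ℂ] LA A Φ := (TensorProduct.mk ℂ A (AffVir Φ)).flip

theorem lie_tmul (X Y : AffVir Φ) (a b : A) : ⁅tmul X a, tmul Y b⁆ = tmul ⁅X, Y⁆ (a * b) := rfl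

theorem span_tmul : Submodule.span ℂ {z : LA A Φ | ∃ X a, z = tmul X a} = ⊤ := by
  refine (TensorProduct.span_tmul_eq_top ℂ A (AffVir Φ)).symm.trans ?_ |>.symm
  refine congrArg _ (Set.ext fun z => ?_)
  exact ⟨fun ⟨a, X, h⟩ => ⟨X, a, h.symm⟩, fun ⟨X, a, h⟩ => ⟨a, X, h.symm⟩⟩

end LA

/-! ### Modules -/

section Modules

variable (A : Type*) [CommRing A] [Algebra ℂ A] (Φ : InvForm 𝔤) (H : LieSubalgebra ℂ 𝔤)
  (V : Type*) [AddCommGroup V] [Module ℂ V] [LieRingModule (LA A Φ) V] [LieModule ℂ (LA A Φ) V]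

/-- The space `𝔥 ⊕ ℂ K ⊕ ℂ d 0 ⊕ ℂ C`, where `𝔥 ⊆ 𝔤` is a given subalgebra. -/
abbrev Cartan : Type _ := H × ℂ × ℂ × ℂ

/-- The inclusion `(h, k, r, c) ↦ h ⊗ 1 + k K + r d 0 + c C` of `𝔥 ⊕ ℂ K ⊕ ℂ d 0 ⊕ ℂ C` in `𝔏`. -/
def cartanIncl : Cartan H →ₗ[ℂ] AffVir Φ :=
  ((AffVir.x Φ 0).comp H.subtype).coprod
    ((LinearMap.toSpanSingleton ℂ _ (AffVir.K Φ)).coprod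
      ((LinearMap.toSpanSingleton ℂ _ (AffVir.d Φ 0)).coprod
        (LinearMap.toSpanSingleton ℂ _ (AffVir.C Φ))))

theorem cartanIncl_apply (h : H) (k r c : ℂ) : cartanIncl Φ H (h, k, r, c) =
    AffVir.x Φ 0 (h : 𝔤) + (k • AffVir.K Φ + (r • AffVir.d Φ 0 + c • AffVir.C Φ)) := rfl

/-- The weight space `V_μ`. -/
def weightSpace (μ : Module.Dual ℂ (Cartan H)) : Submodule ℂ V where
  carrier := {v | ∀ h : Cartan H, ⁅(LA.tmul (cartanIncl Φ H h) 1 : LA A Φ), v⁆ = μ h • v}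
  add_mem' hv hw h := by rw [lie_add, hv h, hw h, smul_add]
  zero_mem' h := by rw [lie_zero, smul_zero]
  smul_mem' t v hv h := by rw [lie_smul, hv h, smul_comm]

/-- `V` is the direct sum of its weight spaces. -/
def IsWeightModule : Prop :=
  iSupIndep (weightSpace A Φ H V) ∧ ⨆ μ, weightSpace A Φ H V μ = ⊤

variable [LieAlgebra.IsKilling ℂ 𝔤] [FiniteDimensional ℂ 𝔤] [H.IsCartanSubalgebra]

/-- Integrable modules: weight modules with finite-dimensional weight spaces on which all
`(y ⊗ tⁿ) ⊗ a`, with `y` in a root space of `𝔤`, act locally nilpotently. -/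
structure IsIntegrable : Prop where
  isWeightModule : IsWeightModule A Φ H V
  finiteDimensional : ∀ μ, FiniteDimensional ℂ (weightSpace A Φ H V μ)
  locallyNilpotent : ∀ (α : H.root) (n : ℤ) (y : 𝔤), y ∈ rootSpace H α.1 → ∀ (a : A) (v : V),
    ∃ N : ℕ, (LieModule.toEnd ℂ (LA A Φ) V (LA.tmul (AffVir.x Φ n y) a) ^ N) v = 0

variable {H} (b : (LieAlgebra.IsKilling.rootSystem H).Base)

/-- The subspace `𝔫₊ ⊕ Vir⁺` of `𝔏`, where `𝔫₊` is the sum of the positive root spaces of `𝔤`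
(for the base `b`) and of `𝔤 ⊗ t ℂ[t]`, and `Vir⁺` is spanned by the `d n` with `n > 0`. -/
def posPart : Submodule ℂ (AffVir Φ) := Submodule.span ℂ
  ({X | ∃ α : H.root, b.IsPos α ∧ ∃ y ∈ rootSpace H α.1, X = AffVir.x Φ 0 y} ∪
    {X | ∃ n : ℤ, 0 < n ∧ ∃ y : 𝔤, X = AffVir.x Φ n y} ∪
    {X | ∃ n : ℤ, 0 < n ∧ X = AffVir.d Φ n})

/-- The subspace `𝔫₋ ⊕ Vir⁻` of `𝔏`. -/
def negPart : Submodule ℂ (AffVir Φ) := Submodule.span ℂ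
  ({X | ∃ α : H.root, b.IsPos α ∧ ∃ y ∈ rootSpace H (-(α.1 : H → ℂ)), X = AffVir.x Φ 0 y} ∪
    {X | ∃ n : ℤ, n < 0 ∧ ∃ y : 𝔤, X = AffVir.x Φ n y} ∪
    {X | ∃ n : ℤ, n < 0 ∧ X = AffVir.d Φ n})

/-- The subspace `P ⊗ A` of `𝔏(A)`, for a subspace `P` of `𝔏`. -/
def loopOf {Φ : InvForm 𝔤} (P : Submodule ℂ (AffVir Φ)) : Submodule ℂ (LA A Φ) :=
  Submodule.span ℂ {z | ∃ X ∈ P, ∃ a : A, z = LA.tmul X a}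

/-- `V` is a weight module generated, over the universal enveloping algebra of `𝔏(A)`, by a nonzero
vector of weight `μ` which is annihilated by the subspace `N` of `𝔏(A)`. -/
def IsGeneratedByExtremal (H : LieSubalgebra ℂ 𝔤) (N : Submodule ℂ (LA A Φ))
    (μ : Module.Dual ℂ (Cartan H)) : Prop :=
  IsWeightModule A Φ H V ∧ ∃ v ∈ weightSpace A Φ H V μ, v ≠ 0 ∧ (∀ z ∈ N, ⁅z, v⁆ = 0) ∧
    ∀ w : V, ∃ u : UniversalEnvelopingAlgebra ℂ (LA A Φ),
      UniversalEnvelopingAlgebra.lift ℂ (LieModule.toEnd ℂ (LA A Φ) V) u v = w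

/-- `V` is a highest weight module with highest weight `μ`. -/
def IsHighestWeightModule (μ : Module.Dual ℂ (Cartan H)) : Prop :=
  IsGeneratedByExtremal A Φ V H (loopOf A (posPart Φ b)) μ

/-- `V` is a lowest weight module with lowest weight `μ`. -/
def IsLowestWeightModule (μ : Module.Dual ℂ (Cartan H)) : Prop :=
  IsGeneratedByExtremal A Φ V H (loopOf A (negPart Φ b)) μ

/-- The form is normalized: the highest root `θ` (the root `θ` such that `θ - β` is a sum of simple
roots for every root `β`) has square length `2`. As the coroot of `θ` has square length
`4 / ⟨θ, θ⟩`, this says that `⟨θ^∨, θ^∨⟩ = 2`. -/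
def IsNormalized : Prop :=
  ∃ θ : H.root,
    (∀ β : H.root, (LieAlgebra.IsKilling.rootSystem H).root θ -
        (LieAlgebra.IsKilling.rootSystem H).root β ∈
      AddSubmonoid.closure ((LieAlgebra.IsKilling.rootSystem H).root '' b.support)) ∧
    Φ.form (LieAlgebra.IsKilling.coroot θ.1 : 𝔤) (LieAlgebra.IsKilling.coroot θ.1 : 𝔤) = 2

end Modules

end LoopAffVir

end

open LoopAffVir

/-!
`K` acts by a scalar `c ≠ 0`. The `sl₂`-triples of the real affine roots `α + k δ` act integrably,
which forces every `c ⟨α^∨, α^∨⟩ / 2` to be an integer; as the form is a multiple of the Killing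
form, these integers all have the same sign. The automorphism `t ↦ t⁻¹`, `K ↦ -K` reduces the
negative case to the positive one.

In the positive case the lowering operators of two opposite real roots, sufficiently far down in
the `δ`-direction, embed a weight space of degree `n` into the one of degree `n - m` for the same
`𝔥`-weight, so the multiplicities in non-negative degrees are bounded. The Heisenberg algebras
spanned by `h ⊗ t^{±1}` and `h ⊗ t^{±2}` would make them unbounded if weights occurred in
arbitrarily high degree, so for each `𝔥`-weight the degrees are bounded above. Subtracting real
roots raises the degree and shortens the `𝔥`-weight until it lies in a finite set; hence there is a
greatest degree, and only finitely many weights occur in it.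

A weight of greatest degree and, in that degree, of greatest height is killed by the positive part.
A subspace of its weight space that is stable under the commuting operators `𝔥̄ ⊗ A` generates a
module that meets the weight space in that subspace only, so a common eigenvector spans it.
-/

namespace LoopAffVir

section LieModules

theorem exists_inf_eigenspace_ne_bot {K V : Type*} [Field K] [IsAlgClosed K] [AddCommGroup V]
    [Module K V] {T : Module.End K V} {W : Submodule K V} [FiniteDimensional K W] (hW : W ≠ ⊥)
    (hT : ∀ v ∈ W, T v ∈ W) : ∃ ρ, W ⊓ T.eigenspace ρ ≠ ⊥ := by
  have : Nontrivial W := Submodule.nontrivial_iff_ne_bot.mpr hW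
  obtain ⟨ρ, hρ⟩ := Module.End.exists_eigenvalue (T.restrict hT)
  obtain ⟨⟨w, hwW⟩, hw⟩ := hρ.exists_hasEigenvector
  refine ⟨ρ, Submodule.ne_bot_iff _ |>.mpr ⟨w, ⟨hwW, ?_⟩, fun h => hw.2 (Subtype.ext h)⟩⟩
  exact Module.End.mem_eigenspace_iff.mpr (congrArg Subtype.val hw.apply_eq_smul)

variable {R L V : Type*} [CommRing R] [LieRing L] [AddCommGroup V] [Module R V]
  [LieRingModule L V]

theorem eq_top_of_lie_mem [LieModule.IsIrreducible R L V] {F : Submodule R V}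
    (hF : ∀ (x : L), ∀ v ∈ F, ⁅x, v⁆ ∈ F) {v : V} (hv : v ∈ F) (hv0 : v ≠ 0) : F = ⊤ := by
  let M : LieSubmodule R L V := { F with lie_mem := fun {x w} hw => hF x w hw }
  have hM : M = ⊤ := (eq_bot_or_eq_top M).resolve_left fun h => hv0 <| by
    rwa [← LieSubmodule.mem_bot (R := R) (L := L), ← h]
  exact congrArg LieSubmodule.toSubmodule hM

variable [LieAlgebra R L] [LieModule R L V]

theorem exists_lift_toEnd_apply_eq [LieModule.IsIrreducible R L V] {v : V} (hv : v ≠ 0) (w : V) :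
    ∃ u : UniversalEnvelopingAlgebra R L,
      UniversalEnvelopingAlgebra.lift R (LieModule.toEnd R L V) u v = w := by
  set f := UniversalEnvelopingAlgebra.lift R (LieModule.toEnd R L V) with hf
  have htop : LinearMap.range ((LinearMap.applyₗ v).comp f.toLinearMap) = ⊤ := by
    refine eq_top_of_lie_mem (L := L) ?_ ⟨1, ?_⟩ hv
    · rintro x _ ⟨u, rfl⟩
      refine ⟨UniversalEnvelopingAlgebra.ι R x * u, ?_⟩
      simp [hf]
    · simp
  exact LinearMap.range_eq_top.mp htop w

theorem lie_eq_smul_of_central [LieModule.IsIrreducible R L V] {z : L} (hz : ∀ x : L, ⁅z, x⁆ = 0)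
    {c : R} {v : V} (hv0 : v ≠ 0) (hv : ⁅z, v⁆ = c • v) (w : V) : ⁅z, w⁆ = c • w := by
  have htop : (LieModule.toEnd R L V z).eigenspace c = ⊤ := by
    refine eq_top_of_lie_mem (L := L) (fun x w hw => ?_) (Module.End.mem_eigenspace_iff.mpr hv) hv0
    rw [Module.End.mem_eigenspace_iff, LieModule.toEnd_apply_apply] at hw ⊢
    rw [leibniz_lie, hz, zero_lie, zero_add, hw, lie_smul]
  exact Module.End.mem_eigenspace_iff.mp (htop ▸ Submodule.mem_top)

theorem eq_top_of_triangular [LieModule.IsIrreducible R L V] {N Q : Submodule R L}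
    (hNQ : N ⊔ Q = ⊤) {E F : Submodule R V} (hE : E ≠ ⊥) (hQE : ∀ x ∈ Q, ∀ v ∈ E, ⁅x, v⁆ ∈ E)
    (hEF : E ≤ F) (hNF : ∀ x ∈ N, ∀ v ∈ F, ⁅x, v⁆ ∈ F) : F = ⊤ := by
  let W : Submodule R V := sInf {F | E ≤ F ∧ ∀ x ∈ N, ∀ v ∈ F, ⁅x, v⁆ ∈ F}
  have hEW : E ≤ W := le_sInf fun F hF => hF.1
  have hNW : ∀ x ∈ N, ∀ v ∈ W, ⁅x, v⁆ ∈ W := fun x hx v hv =>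
    Submodule.mem_sInf.mpr fun F hF => hF.2 x hx v (Submodule.mem_sInf.mp hv F hF)
  let S : Submodule R V := W ⊓ ⨅ x ∈ Q, W.comap (LieModule.toEnd R L V x)
  have mem_S {v : V} : v ∈ S ↔ v ∈ W ∧ ∀ x ∈ Q, ⁅x, v⁆ ∈ W := by simp [S]
  have hSW : ∀ (x : L), ∀ v ∈ S, ⁅x, v⁆ ∈ W := fun x v hv => by
    obtain ⟨y, hy, q, hq, rfl⟩ := Submodule.mem_sup.mp (hNQ ▸ Submodule.mem_top : x ∈ N ⊔ Q)
    rw [add_lie]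
    exact W.add_mem (hNW y hy v (mem_S.mp hv).1) ((mem_S.mp hv).2 q hq)
  have hWS : W ≤ S := sInf_le ⟨fun v hv => mem_S.mpr ⟨hEW hv, fun x hx => hEW (hQE x hx v hv)⟩,
    fun x hx v hv => mem_S.mpr ⟨hNW x hx v (mem_S.mp hv).1, fun y hy => by
      rw [leibniz_lie]
      exact W.add_mem (hSW _ v hv) (hNW x hx _ ((mem_S.mp hv).2 y hy))⟩⟩
  obtain ⟨v, hv, hv0⟩ := Submodule.exists_mem_ne_zero_of_ne_bot hE
  have hW : W = ⊤ := eq_top_of_lie_mem (fun x v hv => hSW x v (hWS hv)) (hEW hv) hv0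
  exact top_le_iff.mp (hW ▸ sInf_le ⟨hEF, hNF⟩)

end LieModules

section LieModulesField

variable {K L V : Type*} [Field K] [LieRing L] [LieAlgebra K L] [AddCommGroup V]
  [Module K V] [LieRingModule L V] [LieModule K L V]

theorem lie_mem_iSup_eigenspace {D x : L} {r : K}
    (hx : x ∈ Submodule.span K {x : L | ∃ j : ℕ, ⁅D, x⁆ = -(j + 1 : K) • x}) (i : ℕ) {v : V}
    (hv : v ∈ (LieModule.toEnd K L V D).eigenspace (r - i)) :
    ⁅x, v⁆ ∈ ⨆ j : ℕ, (LieModule.toEnd K L V D).eigenspace (r - (j + 1 : ℕ)) := by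
  set S := ⨆ j : ℕ, (LieModule.toEnd K L V D).eigenspace (r - (j + 1 : ℕ))
  induction hx using Submodule.span_induction with
  | mem x hx =>
    obtain ⟨j, hj⟩ := hx
    refine Submodule.mem_iSup_of_mem (i + j) (Module.End.mem_eigenspace_iff.mpr ?_)
    rw [Module.End.mem_eigenspace_iff, LieModule.toEnd_apply_apply] at hv
    rw [LieModule.toEnd_apply_apply, leibniz_lie, hj, smul_lie, hv, lie_smul, ← add_smul]
    congr 1
    push_cast
    ring
  | zero => simp
  | add x y _ _ hx hy => rw [add_lie]; exact S.add_mem hx hy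
  | smul t x _ hx => rw [smul_lie]; exact S.smul_mem t hx

theorem eq_of_le_of_lowering [CharZero K] [LieModule.IsIrreducible K L V] {N Q : Submodule K L}
    (hNQ : N ⊔ Q = ⊤) {D : L} {r : K}
    (hN : N ≤ Submodule.span K {x : L | ∃ j : ℕ, ⁅D, x⁆ = -(j + 1 : K) • x})
    {E F : Submodule K V} (hF : F ≤ (LieModule.toEnd K L V D).eigenspace r) (hEF : E ≤ F)
    (hE : E ≠ ⊥) (hQE : ∀ x ∈ Q, ∀ v ∈ E, ⁅x, v⁆ ∈ E) : E = F := by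
  set T := LieModule.toEnd K L V D
  set S : Submodule K V := ⨆ j : ℕ, T.eigenspace (r - (j + 1 : ℕ))
  have hFS : Disjoint F S := (T.eigenspaces_iSupIndep r).mono hF <| iSup_le fun j =>
    le_iSup₂_of_le (r - (j + 1 : ℕ)) (by simp [Nat.cast_add_one_ne_zero]) le_rfl
  have hNS : ∀ x ∈ N, ∀ v ∈ E ⊔ S, ⁅x, v⁆ ∈ E ⊔ S := fun x hx v hv => by
    have hle : E ⊔ S ≤ S.comap (LieModule.toEnd K L V x) := sup_le
      (fun v hv => lie_mem_iSup_eigenspace (hN hx) 0 <| by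
        simpa only [Nat.cast_zero, sub_zero] using hF (hEF hv))
      (iSup_le fun j v hv => lie_mem_iSup_eigenspace (hN hx) (j + 1) hv)
    exact Submodule.mem_sup_right (hle hv)
  have htop : E ⊔ S = ⊤ := eq_top_of_triangular hNQ hE hQE le_sup_left hNS
  calc E = E ⊔ S ⊓ F := by rw [hFS.symm.eq_bot, sup_bot_eq]
    _ = F := by rw [← sup_inf_assoc_of_le S hEF, htop, top_inf_eq]

theorem finrank_eq_one_of_triangular [IsAlgClosed K] [CharZero K]
    [LieModule.IsIrreducible K L V] {N P T : Submodule K L} (hNPT : N ⊔ (P ⊔ T) = ⊤) {D : L} {r : K}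
    (hN : N ≤ Submodule.span K {x : L | ∃ j : ℕ, ⁅D, x⁆ = -(j + 1 : K) • x})
    (hT : ∀ x ∈ T, ∀ y ∈ T, ⁅x, y⁆ = 0) {E : Submodule K V} [FiniteDimensional K E] (hE : E ≠ ⊥)
    (hED : E ≤ (LieModule.toEnd K L V D).eigenspace r) (hPE : ∀ x ∈ P, ∀ v ∈ E, ⁅x, v⁆ = 0)
    (hTE : ∀ x ∈ T, ∀ v ∈ E, ⁅x, v⁆ ∈ E) : Module.finrank K E = 1 := by
  have eq_of_stable : ∀ F ≤ E, F ≠ ⊥ → (∀ x ∈ T, ∀ v ∈ F, ⁅x, v⁆ ∈ F) → F = E :=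
    fun F hFE hF hTF => eq_of_le_of_lowering hNPT hN hED hFE hF fun x hx v hv => by
      obtain ⟨y, hy, z, hz, rfl⟩ := Submodule.mem_sup.mp hx
      rw [add_lie, hPE y hy v (hFE hv), zero_add]
      exact hTF z hz v hv
  have scalar : ∀ x ∈ T, ∃ t : K, ∀ v ∈ E, ⁅x, v⁆ = t • v := fun x hx => by
    obtain ⟨t, ht⟩ := exists_inf_eigenspace_ne_bot (T := LieModule.toEnd K L V x) hE (hTE x hx)
    have hEt := eq_of_stable _ inf_le_left ht fun y hy v hv => by
      have hxv : ⁅x, v⁆ = t • v := Module.End.mem_eigenspace_iff.mp hv.2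
      refine ⟨hTE y hy v hv.1, Module.End.mem_eigenspace_iff.mpr ?_⟩
      rw [LieModule.toEnd_apply_apply, leibniz_lie, hT x hx y hy, zero_lie, zero_add, hxv, lie_smul]
    exact ⟨t, fun v hv => Module.End.mem_eigenspace_iff.mp (inf_eq_left.mp hEt hv)⟩
  obtain ⟨v, hv, hv0⟩ := Submodule.exists_mem_ne_zero_of_ne_bot hE
  have hspan : K ∙ v = E := by
    have hle : K ∙ v ≤ E := by rwa [Submodule.span_singleton_le_iff_mem]
    refine eq_of_stable _ hle (by rwa [Ne, Submodule.span_singleton_eq_bot]) fun x hx w hw => ?_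
    obtain ⟨t, ht⟩ := scalar x hx
    rw [ht w (hle hw)]
    exact Submodule.smul_mem _ t hw
  rw [← hspan, finrank_span_singleton hv0]

end LieModulesField

section Sl2

open LieModule

variable {R L V : Type*} [CommRing R] [IsDomain R] [CharZero R] [LieRing L] [LieAlgebra R L]
  [AddCommGroup V] [Module R V] [Module.IsTorsionFree R V] [LieRingModule L V] [LieModule R L V]
  {h e f : L} {v : V}

theorem exists_nat_of_hasPrimitiveVectorWith {t : IsSl2Triple h e f} {μ : R}
    (P : t.HasPrimitiveVectorWith v μ) (hf : ∃ N, (toEnd R L V f ^ N) v = 0) : ∃ n : ℕ, μ = n := by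
  obtain ⟨n, hn, hn'⟩ := Nat.exists_not_and_succ_of_not_zero_of_exists
    (p := fun N => (toEnd R L V f ^ N) v = 0) P.ne_zero hf
  have hlie := P.lie_e_pow_succ_toEnd_f n
  rw [hn', lie_zero, eq_comm, smul_eq_zero_iff_left hn, mul_eq_zero, sub_eq_zero] at hlie
  exact ⟨n, hlie.resolve_left (Nat.cast_add_one_ne_zero n)⟩

theorem exists_int_eigenvalue (t : IsSl2Triple h e f) (he : ∀ v, ∃ N, (toEnd R L V e ^ N) v = 0)
    (hf : ∀ v, ∃ N, (toEnd R L V f ^ N) v = 0) (hv0 : v ≠ 0) {μ : R} (hv : ⁅h, v⁆ = μ • v) :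
    ∃ p : ℤ, μ = p := by
  obtain ⟨k, hk, hk'⟩ := Nat.exists_not_and_succ_of_not_zero_of_exists
    (p := fun N => (toEnd R L V e ^ N) v = 0) hv0 (he v)
  have P : t.HasPrimitiveVectorWith ((toEnd R L V e ^ k) v) (μ + 2 * k) :=
    ⟨hk, t.lie_h_pow_toEnd_e hv k, (IsSl2Triple.lie_e_pow_toEnd_e k).trans hk'⟩
  obtain ⟨n, hn⟩ := exists_nat_of_hasPrimitiveVectorWith P (hf _)
  exact ⟨n - 2 * k, by push_cast; rw [← hn, add_sub_cancel_right]⟩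

theorem lie_f_ne_zero_of_pos (t : IsSl2Triple h e f) (he : ∃ N, (toEnd R L V e ^ N) v = 0)
    (hv0 : v ≠ 0) {p : ℤ} (hp : 0 < p) (hv : ⁅h, v⁆ = (p : R) • v) : ⁅f, v⁆ ≠ 0 := fun hfv => by
  have P : t.symm.HasPrimitiveVectorWith v (-p : R) := ⟨hv0, by rw [neg_lie, hv, neg_smul], hfv⟩
  obtain ⟨n, hn⟩ := exists_nat_of_hasPrimitiveVectorWith P he
  have : -p = n := by exact_mod_cast hn
  omega

end Sl2

section Heisenberg

variable {K V : Type*} [Field K] [AddCommGroup V] [Module K V]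

open Module.End

theorem pow_apply_mem {W : ℤ → Submodule K V} {s : Module.End K V} {d : ℤ}
    (hs : ∀ n, ∀ v ∈ W n, s v ∈ W (n + d)) (j : ℕ) {n : ℤ} {v : V} (hv : v ∈ W n) :
    (s ^ j) v ∈ W (n + j * d) := by
  induction j with
  | zero => simpa using hv
  | succ j ih =>
    rw [pow_succ', mul_apply, Nat.cast_succ, add_one_mul, ← add_assoc]
    exact hs _ _ ih

theorem hasEigenvector_apply_of_commute {T s : Module.End K V} (h : Commute T s) {ρ : K} {v : V}
    (hv : T.HasEigenvector ρ v) (hsv : s v ≠ 0) : T.HasEigenvector ρ (s v) :=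
  ⟨mem_eigenspace_iff.mpr <| by
    rw [← mul_apply, h.eq, mul_apply, hv.apply_eq_smul, map_smul], hsv⟩

theorem card_le_finrank_of_hasEigenvector {ι : Type*} [Fintype ι] {T : Module.End K V}
    {W : Submodule K V} [FiniteDimensional K W] {μ : ι → K} (hμ : Function.Injective μ)
    {u : ι → V} (hu : ∀ i, T.HasEigenvector (μ i) (u i)) (huW : ∀ i, u i ∈ W) :
    Fintype.card ι ≤ Module.finrank K W :=
  (LinearIndependent.of_comp W.subtype (v := fun i => (⟨u i, huW i⟩ : W))
    (eigenvectors_linearIndependent' T μ hμ u hu)).fintype_card_le_finrank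

theorem hasEigenvector_pow_apply {T s : Module.End K V} {ρ σ : K}
    (hTs : T * s = s * T + σ • s)
    (hs : ∀ (j : ℕ) (v : V), T.HasEigenvector (ρ + j * σ) v → s v ≠ 0) {v : V}
    (hv : T.HasEigenvector ρ v) (j : ℕ) : T.HasEigenvector (ρ + j * σ) ((s ^ j) v) := by
  induction j with
  | zero => simpa using hv
  | succ j ih =>
    rw [pow_succ', mul_apply]
    refine ⟨mem_eigenspace_iff.mpr ?_, hs j _ ih⟩
    rw [← mul_apply, hTs, LinearMap.add_apply, mul_apply, ih.apply_eq_smul, map_smul,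
      LinearMap.smul_apply, ← add_smul]
    push_cast
    ring_nf

theorem exists_ladder_operator [CharZero K] {a b : Module.End K V} {κ : K} (hκ : κ ≠ 0)
    (hab : a * b - b * a = κ • 1) (ρ : K) :
    ∃ s ∈ ({a, b} : Set (Module.End K V)), ∃ σ ≠ 0, ∀ v, (b * a).HasEigenvector ρ v →
      ∀ j : ℕ, (b * a).HasEigenvector (ρ + j * σ) ((s ^ j) v) := by
  have hab' : a * b = b * a + κ • 1 := sub_eq_iff_eq_add'.mp hab
  by_cases hρ : ∃ k : ℕ, ρ = k * κ
  · obtain ⟨k, rfl⟩ := hρ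
    have hb : b * a * b = b * (b * a) + κ • b := by rw [mul_assoc, hab', mul_add, mul_smul_one]
    refine ⟨b, by simp, κ, hκ, fun v hv => hasEigenvector_pow_apply hb (fun j w hw hbw => ?_) hv⟩
    have haw : a (b w) = ((k + j + 1 : ℕ) * κ) • w := by
      rw [← mul_apply, hab', LinearMap.add_apply, hw.apply_eq_smul, LinearMap.smul_apply,
        one_apply, ← add_smul]
      push_cast
      ring_nf
    rw [hbw, map_zero, eq_comm, smul_eq_zero_iff_left hw.2] at haw
    exact mul_ne_zero (Nat.cast_ne_zero.mpr (by omega)) hκ haw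
  · have ha : b * a * a = a * (b * a) + -κ • a := by
      rw [← mul_assoc, hab', add_mul, smul_one_mul, neg_smul, add_neg_cancel_right]
    refine ⟨a, by simp, -κ, neg_ne_zero.mpr hκ, fun v hv =>
      hasEigenvector_pow_apply ha (fun j w hw haw => hρ ⟨j, ?_⟩) hv⟩
    have hbw := hw.apply_eq_smul
    rw [mul_apply, haw, map_zero, eq_comm, smul_eq_zero_iff_left hw.2] at hbw
    linear_combination hbw

variable {x : ℤ → Module.End K V} {κ : K}
  (hx : ∀ k l, x k * x l - x l * x k = (if l = -k then (k : K) * κ else 0) • 1)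
include hx

theorem commute_of_ne_neg {k l : ℤ} (hkl : l ≠ -k) : Commute (x k) (x l) := by
  have h := hx k l
  rwa [if_neg hkl, zero_smul, sub_eq_zero] at h

theorem commute_mul_of_ne {k l : ℤ} (h : l ≠ k) (h' : l ≠ -k) : Commute (x (-k) * x k) (x l) :=
  (commute_of_ne_neg hx (by simpa)).mul_left (commute_of_ne_neg hx h')

theorem exists_ladder_sign [CharZero K] (hκ : κ ≠ 0) {k : ℤ} (hk : k ≠ 0) (ρ : K) :
    ∃ (ε : ℤˣ) (σ : K), σ ≠ 0 ∧ ∀ v, (x (-k) * x k).HasEigenvector ρ v →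
      ∀ j : ℕ, (x (-k) * x k).HasEigenvector (ρ + j * σ) ((x (ε * k) ^ j) v) := by
  obtain ⟨s, hs, σ, hσ, h⟩ := exists_ladder_operator (a := x k) (b := x (-k))
    (mul_ne_zero (Int.cast_ne_zero.mpr hk) hκ) (by rw [hx, if_pos rfl]) ρ
  rcases hs with rfl | rfl
  · exact ⟨1, σ, hσ, by simpa using h⟩
  · exact ⟨-1, σ, hσ, by simpa using h⟩

variable [IsAlgClosed K] {W : ℤ → Submodule K V} [∀ n, FiniteDimensional K (W n)]
  (hW : ∀ k n, ∀ v ∈ W n, x k v ∈ W (n + k))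
include hW

theorem exists_common_eigenvector {n : ℤ} (hn : W n ≠ ⊥) :
    ∃ v ∈ W n, ∃ ρ ρ' : K, (x (-1) * x 1).HasEigenvector ρ v ∧
      (x (-2) * x 2).HasEigenvector ρ' v := by
  have hstable : ∀ k, ∀ v ∈ W n, (x (-k) * x k) v ∈ W n := fun k v hv => by
    simpa using hW (-k) _ _ (hW k n v hv)
  obtain ⟨ρ, hρ⟩ := exists_inf_eigenspace_ne_bot hn (hstable 1)
  have hcomm : Commute (x (-1) * x 1) (x (-2) * x 2) :=
    (commute_mul_of_ne hx (by simp) (by simp)).mul_right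
      (commute_mul_of_ne hx (by simp) (by simp))
  obtain ⟨ρ', hρ'⟩ := exists_inf_eigenspace_ne_bot hρ (T := x (-2) * x 2) fun v hv =>
    ⟨hstable 2 v hv.1, by simpa using Module.End.mapsTo_genEigenspace_of_comm hcomm ρ 1 hv.2⟩
  obtain ⟨v, ⟨⟨hvW, hv⟩, hv'⟩, hv0⟩ := Submodule.exists_mem_ne_zero_of_ne_bot hρ'
  exact ⟨v, hvW, ρ, ρ', ⟨hv, hv0⟩, ⟨hv', hv0⟩⟩

theorem exists_lt_finrank_of_heisenberg [CharZero K] (hκ : κ ≠ 0) {n : ℤ} (hn : W n ≠ ⊥) (M : ℕ) :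
    ∃ n', n - 2 * M ≤ n' ∧ M < Module.finrank K (W n') := by
  obtain ⟨v, hvW, ρ, ρ', hv, hv'⟩ := exists_common_eigenvector hx hW hn
  obtain ⟨ε', _, -, hs'⟩ := exists_ladder_sign hx hκ two_ne_zero ρ'
  obtain ⟨ε, σ, hσ, hs⟩ := exists_ladder_sign hx hκ one_ne_zero ρ
  -- after `2 * i` steps by `ε`, return to a degree independent of `i` in `j` steps by `2 * ε'`
  obtain ⟨n', hn', hdeg⟩ : ∃ n', n - 2 * M ≤ n' ∧
      ∀ i : Fin (M + 1), ∃ j : ℕ, n + (2 * i : ℕ) * (ε * 1) + j * (ε' * 2) = n' := by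
    rcases Int.units_eq_one_or ε with rfl | rfl <;> rcases Int.units_eq_one_or ε' with rfl | rfl
    · exact ⟨n + 2 * M, by omega, fun i => ⟨M - i, by push_cast; omega⟩⟩
    · exact ⟨n, by omega, fun i => ⟨i, by push_cast; omega⟩⟩
    · exact ⟨n, by omega, fun i => ⟨i, by push_cast; omega⟩⟩
    · exact ⟨n - 2 * M, by omega, fun i => ⟨M - i, by push_cast; omega⟩⟩
  choose j hj using hdeg
  let w (i : Fin (M + 1)) : V := (x (ε * 1) ^ (2 * i : ℕ)) v
  have hcomm : Commute (x (-2) * x 2) (x (ε * 1)) := by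
    rcases Int.units_eq_one_or ε with rfl | rfl <;> exact commute_mul_of_ne hx (by simp) (by simp)
  have hcomm' : Commute (x (-1) * x 1) (x (ε' * 2)) := by
    rcases Int.units_eq_one_or ε' with rfl | rfl <;> exact commute_mul_of_ne hx (by simp) (by simp)
  have hw (i : Fin (M + 1)) : (x (-2) * x 2).HasEigenvector ρ' (w i) :=
    hasEigenvector_apply_of_commute (hcomm.pow_right _) hv' (hs v hv _).2
  have hu (i : Fin (M + 1)) :
      (x (-1) * x 1).HasEigenvector (ρ + (2 * i : ℕ) * σ) ((x (ε' * 2) ^ j i) (w i)) :=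
    hasEigenvector_apply_of_commute (hcomm'.pow_right _) (hs v hv _) (hs' _ (hw i) _).2
  refine ⟨n', hn', ?_⟩
  have hcard := card_le_finrank_of_hasEigenvector (W := W n') (fun i i' h => by
    simpa [hσ, Fin.ext_iff] using h) hu fun i =>
      hj i ▸ pow_apply_mem (hW _) (j i) (pow_apply_mem (hW _) _ hvW)
  simpa [Nat.succ_le_iff] using hcard

end Heisenberg

section RootPairings

variable {ι R M N : Type*} [CommRing R] [AddCommGroup M] [Module R M] [AddCommGroup N] [Module R N]

/-- An integral weight of a root pairing. -/
def IsIntegralWeight (P : RootPairing ι R M N) (x : M) : Prop :=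
  ∀ i, ∃ p : ℤ, P.coroot' i x = p

variable {P : RootPairing ι R M N}

theorem isIntegralWeight_root [P.IsCrystallographic] (i : ι) : IsIntegralWeight P (P.root i) :=
  fun j => ⟨P.pairingIn ℤ i j, by simpa using! (P.algebraMap_pairingIn ℤ i j).symm⟩

theorem IsIntegralWeight.coroot'_mem_Icc {x : M} (hx : IsIntegralWeight P x) {a : ℤ}
    (hle : ∀ i (p : ℤ), P.coroot' i x = p → p ≤ a) (i : ι) :
    ∃ p ∈ Set.Icc (-a) a, P.coroot' i x = p := by
  obtain ⟨p, hp⟩ := hx i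
  have hneg : P.coroot' (P.reflectionPerm i i) x = ((-p : ℤ) : R) := by
    rw [RootPairing.coroot', P.coroot_reflectionPerm, P.coreflection_apply_self, map_neg,
      LinearMap.neg_apply, Int.cast_neg, neg_inj]
    exact hp
  have hlow := hle _ _ hneg
  exact ⟨p, ⟨by omega, hle i p hp⟩, hp⟩

theorem finite_setOf_coroot'_mem_Icc [Finite ι] [P.IsRootSystem] (a : ℤ) :
    {x : M | ∀ i, ∃ p ∈ Set.Icc (-a) a, P.coroot' i x = (p : R)}.Finite := by
  have hfin : (Set.univ.pi fun _ : ι => ((↑) '' Set.Icc (-a) a : Set R)).Finite :=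
    Set.Finite.pi fun _ => (Set.finite_Icc _ _).image _
  refine (hfin.preimage (f := fun x i => P.coroot' i x) fun x _ y _ hxy => ?_).subset
    fun x hx i _ => ?_
  · refine P.toPerfPair.injective (LinearMap.ext_on (s := Set.range P.coroot)
      RootPairing.IsRootSystem.span_coroot_eq_top ?_)
    rintro _ ⟨i, rfl⟩
    exact congrFun hxy i
  · obtain ⟨p, hp, hx⟩ := hx i
    exact ⟨p, hp, hx.symm⟩

variable [Fintype ι]

theorem IsIntegralWeight.exists_nat_rootForm {x : M} (hx : IsIntegralWeight P x) :
    ∃ n : ℕ, P.RootForm x x = n := by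
  choose p hp using hx
  refine ⟨∑ i, (p i).natAbs ^ 2, ?_⟩
  rw [RootPairing.rootForm_apply_apply]
  push_cast
  refine Finset.sum_congr rfl fun i _ => ?_
  rw [hp, ← sq, ← Int.cast_natCast, ← Int.cast_pow, ← Int.cast_pow, Int.natAbs_sq]

theorem exists_pos_rootForm_root [CharZero R] [P.IsCrystallographic] [P.IsAnisotropic] (i : ι) :
    ∃ n : ℕ, 0 < n ∧ P.RootForm (P.root i) (P.root i) = n := by
  obtain ⟨n, hn⟩ := (isIntegralWeight_root (P := P) i).exists_nat_rootForm
  refine ⟨n, Nat.pos_of_ne_zero ?_, hn⟩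
  rintro rfl
  exact RootPairing.IsAnisotropic.rootForm_root_ne_zero i (by simpa using hn)

theorem rootForm_sub_root (x : M) (i : ι) :
    P.RootForm (x - P.root i) (x - P.root i) =
      P.RootForm x x - (P.coroot' i x - 1) * P.RootForm (P.root i) (P.root i) := by
  have hrefl := P.rootForm_reflection_reflection_apply i x (P.root i)
  have hsymm := P.rootForm_symmetric.eq (P.root i) x
  rw [RootPairing.reflection_apply_self, RootPairing.reflection_apply] at hrefl
  simp only [map_sub, map_neg, LinearMap.sub_apply, map_smul, LinearMap.smul_apply, smul_eq_mul,
    RingHom.id_apply] at hrefl hsymm ⊢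
  linear_combination hrefl - hsymm

end RootPairings

section InvariantForms

variable {K L : Type*} [Field K] [IsAlgClosed K] [LieRing L] [LieAlgebra K L]
  [FiniteDimensional K L] [LieAlgebra.IsSimple K L]

theorem exists_eq_smul_of_lieInvariant {B B' : LinearMap.BilinForm K L} (hB : B.lieInvariant L)
    (hB' : B'.lieInvariant L) (hnd : B.Nondegenerate) : ∃ s : K, B' = s • B := by
  have : Nontrivial L := LieAlgebra.IsSimple.nontrivial K L
  let T : Module.End K L := (B.flip.toDual hnd.flip).symm ∘ₗ B'.flip
  have hT : ∀ x y, B x (T y) = B' x y := fun x y =>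
    LinearMap.BilinForm.apply_toDual_symm_apply (hB := hnd.flip) (B'.flip y) x
  obtain ⟨s, hs⟩ := Module.End.exists_eigenvalue T
  obtain ⟨v, hv⟩ := hs.exists_hasEigenvector
  have hinv : (B' - s • B).lieInvariant L := fun x y z => by
    simp only [LinearMap.sub_apply, LinearMap.smul_apply, hB x y z, hB' x y z, smul_neg, neg_sub]
    abel
  have hv' : v ∈ LieAlgebra.InvariantForm.orthogonal _ hinv (⊤ : LieIdeal K L) := by
    rw [LieAlgebra.InvariantForm.mem_orthogonal]
    intro x _
    simp [← hT, hv.apply_eq_smul]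
  have htop : LieAlgebra.InvariantForm.orthogonal _ hinv (⊤ : LieIdeal K L) = ⊤ :=
    (LieAlgebra.IsSimple.eq_bot_or_eq_top (R := K) _).resolve_left fun h =>
      hv.2 (by rwa [h, LieSubmodule.mem_bot] at hv')
  refine ⟨s, sub_eq_zero.mp (LinearMap.ext₂ fun x y => ?_)⟩
  have hy : y ∈ LieAlgebra.InvariantForm.orthogonal _ hinv (⊤ : LieIdeal K L) := by
    rw [htop]
    exact LieSubmodule.mem_top y
  exact (LieAlgebra.InvariantForm.mem_orthogonal _ hinv _ _).mp hy x (LieSubmodule.mem_top x)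

end InvariantForms

section KillingForm

open LieAlgebra.IsKilling

variable {K L : Type*} [Field K] [CharZero K] [IsAlgClosed K] [LieRing L] [LieAlgebra K L]
  [FiniteDimensional K L] (H : LieSubalgebra K L) [H.IsCartanSubalgebra]

theorem nonempty_root [LieAlgebra.IsSimple K L] : Nonempty H.root := by
  by_contra hempty
  have := not_nonempty_iff.mp hempty
  have := RootPairing.IsIrreducible.nontrivial (rootSystem H)
  have hspan := RootPairing.IsRootSystem.span_root_eq_top (P := rootSystem H)
  rw [Set.range_eq_empty, Submodule.span_empty] at hspan
  exact bot_ne_top hspan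

theorem exists_pos_killingForm_coroot [LieAlgebra.IsKilling K L] (α : H.root) :
    ∃ n : ℕ, 0 < n ∧ killingForm K L (coroot α.1) (coroot α.1) = n := by
  obtain ⟨n, hn, h⟩ := exists_pos_rootForm_root (P := (rootSystem H).flip) α
  refine ⟨n, hn, Eq.trans ?_ h⟩
  exact (LinearMap.congr_fun₂ (corootForm_rootSystem_eq_killing H) (coroot α.1) (coroot α.1)).symm

variable {H} in
theorem exists_sign_of_lieInvariant [LieAlgebra.IsSimple K L] {B : LinearMap.BilinForm K L}
    (hB : B.lieInvariant L) (hB0 : B ≠ 0)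
    (hBint : ∀ α : H.root, ∃ p : ℤ, B (coroot α.1) (coroot α.1) = 2 * p) :
    ∃ (ε : ℤˣ) (q : H.root → ℤ),
      ∀ α, 0 < q α ∧ B (coroot α.1) (coroot α.1) = 2 * ((ε * q α : ℤ) : K) := by
  obtain ⟨s, rfl⟩ := exists_eq_smul_of_lieInvariant (LieModule.traceForm_lieInvariant K L L) hB
    (killingForm_nondegenerate K L)
  choose p hp using hBint
  choose n hn hκ using exists_pos_killingForm_coroot H
  have hpn : ∀ α, s * n α = 2 * p α := fun α => by rw [← hp, ← hκ]; rfl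
  obtain ⟨β⟩ := nonempty_root H
  have hratio : ∀ α, p α * n β = p β * n α := fun α => by
    have : (p α * n β : K) = p β * n α := by
      linear_combination (n α * hpn β - n β * hpn α) / 2
    exact_mod_cast this
  have hpos : ∀ ε : ℤ, 0 < ε * p β → ∀ α, 0 < ε * p α := fun ε hε α => by
    have hn' := Int.natCast_pos.mpr (hn α)
    refine pos_of_mul_pos_left (b := (n β : ℤ)) ?_ (Int.natCast_nonneg _)
    rw [mul_assoc, hratio, ← mul_assoc]
    positivity
  have hβ : p β ≠ 0 := fun h => by
    have hs : s ≠ 0 := fun hs => hB0 (by rw [hs, zero_smul])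
    simpa [h, hs, (hn β).ne'] using hpn β
  rcases hβ.lt_or_gt with h | h
  · exact ⟨-1, -p, fun α => ⟨by simpa using hpos (-1) (by omega) α, by simpa using hp α⟩⟩
  · exact ⟨1, p, fun α => ⟨by simpa using hpos 1 (by omega) α, by simpa using hp α⟩⟩

end KillingForm

section AffineRepresentations

open LieAlgebra LieAlgebra.IsKilling LieModule

attribute [local instance] LieRing.ofAssociativeRing LieAlgebra.ofAssociativeAlgebra

variable {𝔤 : Type*} [LieRing 𝔤] [LieAlgebra ℂ 𝔤]

theorem coroot_reflectionPerm_self [FiniteDimensional ℂ 𝔤] [IsKilling ℂ 𝔤]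
    {H : LieSubalgebra ℂ 𝔤} [H.IsCartanSubalgebra] (α : H.root) :
    coroot ((rootSystem H).reflectionPerm α α).1 = -coroot α.1 :=
  ((rootSystem H).coroot_reflectionPerm α α).trans ((rootSystem H).coreflection_apply_self α)

theorem exists_isSl2Triple_coroot [FiniteDimensional ℂ 𝔤] [IsKilling ℂ 𝔤]
    {H : LieSubalgebra ℂ 𝔤} [H.IsCartanSubalgebra] (Φ : InvForm 𝔤) (α : H.root) :
    ∃ e ∈ rootSpace H α.1, ∃ f ∈ rootSpace H (-(α.1 : H → ℂ)),
      IsSl2Triple (coroot α.1 : 𝔤) e f ∧ Φ.form (coroot α.1) (coroot α.1) = 2 * Φ.form e f := by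
  have hα := H.isNonZero_coe_root α
  obtain ⟨h, e, f, t, he, hf⟩ := exists_isSl2Triple_of_weight_isNonZero hα
  obtain rfl := t.h_eq_coroot hα he hf
  refine ⟨e, he, f, hf, t, ?_⟩
  have hinv := Φ.invariant e f (coroot α.1)
  rwa [t.lie_e_f, ← lie_skew, t.lie_h_e_nsmul, map_neg, neg_neg, map_nsmul, Φ.symm.eq f e,
    nsmul_eq_mul, Nat.cast_ofNat] at hinv

/-- A representation of `𝔤 ⊗ ℂ[t, t⁻¹] ⊕ ℂ K`, with `X n y` the action of `y ⊗ t ^ n` and `K`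
acting by the scalar `level`, integrable with finite-dimensional weight spaces. The space `W l n` is
only a piece on which `H` acts by `l` and which lies in degree `n`: it need not be the full weight
space, so that eigenvalues of further commuting operators can be fixed as well. -/
structure AffRep (Φ : InvForm 𝔤) (H : LieSubalgebra ℂ 𝔤) [LieRing.IsNilpotent H]
    (V : Type*) [AddCommGroup V] [Module ℂ V] where
  X : ℤ → 𝔤 →ₗ[ℂ] Module.End ℂ V
  level : ℂ
  W : Module.Dual ℂ H → ℤ → Submodule ℂ V
  lie_X : ∀ n m y z, ⁅X n y, X m z⁆ =
    X (n + m) ⁅y, z⁆ + ((if m = -n then (n : ℂ) * Φ.form y z else 0) * level) • 1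
  X_zero_apply : ∀ l n, ∀ v ∈ W l n, ∀ h : H, X 0 h v = l h • v
  X_apply_mem : ∀ l n k (χ : Module.Dual ℂ H), ∀ y ∈ rootSpace H (χ : H → ℂ), ∀ v ∈ W l n,
    X k y v ∈ W (l + χ) (n + k)
  finiteDimensional_W : ∀ l n, FiniteDimensional ℂ (W l n)
  exists_X_pow_apply_eq_zero : ∀ (χ : Weight ℂ H 𝔤), χ.IsNonZero → ∀ k, ∀ y ∈ rootSpace H χ, ∀ v,
    ∃ N, (X k y ^ N) v = 0

namespace AffRep

variable {Φ : InvForm 𝔤} {H : LieSubalgebra ℂ 𝔤} {V : Type*} [AddCommGroup V] [Module ℂ V]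

theorem isSl2Triple [LieRing.IsNilpotent H] (ρ : AffRep Φ H V) {h e f : 𝔤}
    (t : IsSl2Triple h e f) (k : ℤ) {s : ℂ}
    (hs : s = k * Φ.form e f * ρ.level) (h0 : ρ.X 0 h + s • 1 ≠ 0) :
    IsSl2Triple (ρ.X 0 h + s • 1) (ρ.X k e) (ρ.X (-k) f) := by
  have hlie : ∀ k' y, ⁅ρ.X 0 h + s • (1 : Module.End ℂ V), ρ.X k' y⁆ = ρ.X k' ⁅h, y⁆ :=
      fun k' y => by
    have hone : ⁅(1 : Module.End ℂ V), ρ.X k' y⁆ = 0 := by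
      rw [LieRing.of_associative_ring_bracket, one_mul, mul_one, sub_self]
    simp [add_lie, smul_lie, hone, ρ.lie_X]
  refine ⟨h0, ?_, ?_, ?_⟩
  · rw [ρ.lie_X, t.lie_e_f, if_pos rfl, add_neg_cancel, hs]
  · rw [hlie, t.lie_h_e_nsmul, map_nsmul]
  · rw [hlie, t.lie_h_f_nsmul, map_neg, map_nsmul]

theorem W_eq_bot_of_finrank_le [H.IsCartanSubalgebra]
    (ρ : AffRep Φ H V) (hlevel : ρ.level ≠ 0) {h : H} (hh : Φ.form h h ≠ 0)
    {l : Module.Dual ℂ H} {a : ℤ} {M : ℕ} (hM : ∀ n, a ≤ n → Module.finrank ℂ (ρ.W l n) ≤ M)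
    {n : ℤ} (hn : a + 2 * M ≤ n) : ρ.W l n = ⊥ := by
  by_contra hne
  have := ρ.finiteDimensional_W
  obtain ⟨n', hn', hlt⟩ := exists_lt_finrank_of_heisenberg (x := fun k => ρ.X k h)
    (κ := Φ.form h h * ρ.level)
    (fun k k' => by
      rw [← LieRing.of_associative_ring_bracket, ρ.lie_X, lie_self, map_zero, zero_add]
      split_ifs <;> ring_nf)
    (W := ρ.W l)
    (fun k n v hv => by
      simpa using ρ.X_apply_mem l n k 0 h (toLieSubmodule_le_rootSpace_zero ℂ 𝔤 H h.2) v hv)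
    (mul_ne_zero hh hlevel) hne M
  have := hM n' (by omega)
  omega

variable [IsKilling ℂ 𝔤] [FiniteDimensional ℂ 𝔤] [H.IsCartanSubalgebra] (ρ : AffRep Φ H V)

theorem exists_lowering (α : H.root) :
    ∃ f ∈ rootSpace H (-(α.1 : H → ℂ)), ∀ (k : ℤ) l n, ∀ v ∈ ρ.W l n, v ≠ 0 →
      ∃ p : ℤ, l (coroot α.1) + k * (ρ.level * Φ.form (coroot α.1) (coroot α.1)) / 2 = p ∧
        (0 < p → ρ.X (-k) f v ≠ 0) := by
  obtain ⟨e, he, f, hf, t, hΦ⟩ := exists_isSl2Triple_coroot Φ α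
  refine ⟨f, hf, fun k l n v hv hv0 => ?_⟩
  set s : ℂ := k * (ρ.level * Φ.form (coroot α.1) (coroot α.1)) / 2 with hs
  have hhv : (ρ.X 0 (coroot α.1) + s • 1) v = (l (coroot α.1) + s) • v := by
    rw [LinearMap.add_apply, ρ.X_zero_apply l n v hv, LinearMap.smul_apply, Module.End.one_apply,
      add_smul]
  by_cases h0 : ρ.X 0 (coroot α.1) + s • 1 = 0
  · rw [h0, LinearMap.zero_apply, eq_comm, smul_eq_zero_iff_left hv0] at hhv
    exact ⟨0, by simpa using hhv, fun h => absurd h (lt_irrefl 0)⟩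
  have t' := ρ.isSl2Triple t k (by rw [hs, hΦ]; ring) h0
  have he' : ∀ v, ∃ N, (toEnd ℂ (Module.End ℂ V) V (ρ.X k e) ^ N) v = 0 :=
    ρ.exists_X_pow_apply_eq_zero α.1 (H.isNonZero_coe_root α) k e he
  have hf' : ∀ v, ∃ N, (toEnd ℂ (Module.End ℂ V) V (ρ.X (-k) f) ^ N) v = 0 :=
    ρ.exists_X_pow_apply_eq_zero (-α.1) (H.isNonZero_coe_root α).neg _ f (by simpa using hf)
  obtain ⟨p, hp⟩ := exists_int_eigenvalue t' he' hf' hv0 hhv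
  exact ⟨p, hp, fun hpos => lie_f_ne_zero_of_pos t' (he' v) hv0 hpos (hp ▸ hhv)⟩

variable {ρ}

theorem isIntegralWeight_of_W_ne_bot {l : Module.Dual ℂ H} {n : ℤ} (h : ρ.W l n ≠ ⊥) :
    IsIntegralWeight (rootSystem H) l := fun α => by
  obtain ⟨v, hv, hv0⟩ := Submodule.exists_mem_ne_zero_of_ne_bot h
  obtain ⟨f, -, hf⟩ := ρ.exists_lowering α
  obtain ⟨p, hp, -⟩ := hf 0 l n v hv hv0
  exact ⟨p, by simpa using hp⟩

theorem exists_int_level_mul_form {l : Module.Dual ℂ H} {n : ℤ} (h : ρ.W l n ≠ ⊥) (α : H.root) :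
    ∃ q : ℤ, ρ.level * Φ.form (coroot α.1) (coroot α.1) = 2 * q := by
  obtain ⟨v, hv, hv0⟩ := Submodule.exists_mem_ne_zero_of_ne_bot h
  obtain ⟨f, -, hf⟩ := ρ.exists_lowering α
  obtain ⟨p₀, hp₀, -⟩ := hf 0 l n v hv hv0
  obtain ⟨p₁, hp₁, -⟩ := hf 1 l n v hv hv0
  refine ⟨p₁ - p₀, ?_⟩
  push_cast at hp₀ hp₁ ⊢
  linear_combination 2 * hp₁ - 2 * hp₀

/-- The level is positive: `level * ⟨α^∨, α^∨⟩ / 2` is the positive integer `q α` for every root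
`α`. -/
def IsPositive (ρ : AffRep Φ H V) (q : H.root → ℤ) : Prop :=
  ∀ α : H.root, ρ.level * Φ.form (coroot α.1) (coroot α.1) = 2 * q α ∧ 0 < q α

namespace IsPositive

variable {q : H.root → ℤ} (hq : ρ.IsPositive q)
include hq

theorem apply_reflectionPerm_self (α : H.root) : q ((rootSystem H).reflectionPerm α α) = q α := by
  have hα := (hq ((rootSystem H).reflectionPerm α α)).1
  rw [coroot_reflectionPerm_self, NegMemClass.coe_neg, map_neg, LinearMap.map_neg₂, neg_neg,
    (hq α).1] at hα
  exact_mod_cast (mul_left_cancel₀ two_ne_zero hα).symm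

theorem finrank_le_finrank_sub_root (α : H.root) {l : Module.Dual ℂ H} {p k : ℤ}
    (hp : l (coroot α.1) = p) (hpos : 0 < p + k * q α) (n : ℤ) :
    Module.finrank ℂ (ρ.W l n) ≤
      Module.finrank ℂ (ρ.W (l - (rootSystem H).root α) (n - k)) := by
  obtain ⟨f, hf, hlow⟩ := ρ.exists_lowering α
  have hmaps : ∀ v ∈ ρ.W l n, ρ.X (-k) f v ∈ ρ.W (l - (rootSystem H).root α) (n - k) :=
    fun v hv => by
      simpa only [sub_eq_add_neg] using ρ.X_apply_mem l n (-k) (-(rootSystem H).root α) f hf v hv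
  have hker : ∀ v ∈ ρ.W l n, ρ.X (-k) f v = 0 → v = 0 := fun v hv hfv => by
    by_contra hv0
    obtain ⟨p', hp', hne⟩ := hlow k l n v hv hv0
    rw [(hq α).1, hp, mul_left_comm, mul_div_cancel_left₀ _ two_ne_zero] at hp'
    have hpp' : p + k * q α = p' := by exact_mod_cast hp'
    exact hne (hpp' ▸ hpos) hfv
  have := ρ.finiteDimensional_W (l - (rootSystem H).root α) (n - k)
  refine LinearMap.finrank_le_finrank_of_injective (f := (ρ.X (-k) f).restrict hmaps) ?_
  rw [← LinearMap.ker_eq_bot, LinearMap.ker_eq_bot']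
  exact fun v hv => Subtype.ext (hker v v.2 (congrArg Subtype.val hv))

theorem exists_finrank_le_finrank_sub [Nonempty H.root] {l : Module.Dual ℂ H}
    (hl : IsIntegralWeight (rootSystem H) l) :
    ∃ m₀ : ℤ, ∀ n m : ℤ, m₀ ≤ m →
      Module.finrank ℂ (ρ.W l n) ≤ Module.finrank ℂ (ρ.W l (n - m)) := by
  obtain ⟨α⟩ := ‹Nonempty H.root›
  obtain ⟨p, hp⟩ : ∃ p : ℤ, l (coroot α.1) = p := hl α
  set k := |p| + 3
  have hpos : ∀ j, k ≤ j → k ≤ j * q α := fun j hj => by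
    nlinarith [(hq α).2, abs_nonneg p]
  have hlp := neg_abs_le p
  have hpu := le_abs_self p
  refine ⟨2 * k, fun n m hm => ?_⟩
  set β := (rootSystem H).reflectionPerm α α with hβ
  have hroot : (rootSystem H).root β = -(rootSystem H).root α :=
    ((rootSystem H).root_reflectionPerm α α).trans ((rootSystem H).reflection_apply_self α)
  have hpβ : (l - (rootSystem H).root α) (coroot β.1) = ((2 - p : ℤ) : ℂ) := by
    have htwo : (rootSystem H).root α (coroot α.1) = 2 :=
      root_apply_coroot (H.isNonZero_coe_root α)
    rw [coroot_reflectionPerm_self, map_neg, LinearMap.sub_apply, hp, htwo]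
    push_cast
    ring
  calc Module.finrank ℂ (ρ.W l n)
      ≤ Module.finrank ℂ (ρ.W (l - (rootSystem H).root α) (n - k)) :=
        hq.finrank_le_finrank_sub_root α hp (by have := hpos k le_rfl; omega) n
    _ ≤ Module.finrank ℂ
          (ρ.W (l - (rootSystem H).root α - (rootSystem H).root β) (n - k - (m - k))) :=
        hq.finrank_le_finrank_sub_root β hpβ (by
          rw [hβ, hq.apply_reflectionPerm_self]
          have := hpos (m - k) (by omega)
          omega) _
    _ = Module.finrank ℂ (ρ.W l (n - m)) := by
        rw [hroot, sub_neg_eq_add, sub_add_cancel, sub_sub_sub_cancel_right]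

theorem eventually_W_eq_bot [Nonempty H.root] (l : Module.Dual ℂ H) :
    ∃ N : ℤ, ∀ n, N ≤ n → ρ.W l n = ⊥ := by
  by_cases hl : IsIntegralWeight (rootSystem H) l
  · obtain ⟨m₀, hm₀⟩ := hq.exists_finrank_le_finrank_sub hl
    obtain ⟨α⟩ := ‹Nonempty H.root›
    have hα : ρ.level * Φ.form (coroot α.1) (coroot α.1) ≠ 0 := by
      rw [(hq α).1]
      exact mul_ne_zero two_ne_zero (Int.cast_ne_zero.mpr (hq α).2.ne')
    exact ⟨_, fun n => ρ.W_eq_bot_of_finrank_le (left_ne_zero_of_mul hα)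
      (right_ne_zero_of_mul hα) fun n hn => (hm₀ n n hn).trans_eq (by rw [sub_self])⟩
  · exact ⟨0, fun n _ => by_contra fun h => hl (isIntegralWeight_of_W_ne_bot h)⟩

theorem W_sub_root_ne_bot {l : Module.Dual ℂ H} {n : ℤ} (h : ρ.W l n ≠ ⊥) (α : H.root) {p : ℤ}
    (hp : l (coroot α.1) = p) (hpq : q α < p) :
    ρ.W (l - (rootSystem H).root α) (n + 1) ≠ ⊥ := by
  have := ρ.finiteDimensional_W
  have hle := hq.finrank_le_finrank_sub_root (k := -1) α hp (by omega) n
  rw [sub_neg_eq_add] at hle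
  rw [← Submodule.one_le_finrank_iff] at h ⊢
  exact h.trans hle

theorem exists_W_ne_bot_coroot'_mem_Icc {M : ℤ} (hM : ∀ α, q α ≤ M) {l : Module.Dual ℂ H} {n : ℤ}
    (h : ρ.W l n ≠ ⊥) :
    ∃ l' n', ρ.W l' n' ≠ ⊥ ∧ n ≤ n' ∧
      ∀ α, ∃ p ∈ Set.Icc (-M) M, (rootSystem H).coroot' α l' = p := by
  obtain ⟨N, hN⟩ := (isIntegralWeight_of_W_ne_bot h).exists_nat_rootForm
  induction N using Nat.strong_induction_on generalizing l n with
  | _ N ih =>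
    by_cases hex : ∃ α, ∃ p : ℤ, l (coroot α.1) = p ∧ q α < p
    · obtain ⟨α, p, hp, hpq⟩ := hex
      have h' := hq.W_sub_root_ne_bot h α hp hpq
      obtain ⟨N', hN'⟩ := (isIntegralWeight_of_W_ne_bot h').exists_nat_rootForm
      have hlt : N' < N := by
        obtain ⟨r, hr0, hr⟩ := exists_pos_rootForm_root (P := rootSystem H) α
        have hsub := rootForm_sub_root (P := rootSystem H) l α
        have hp' : (rootSystem H).coroot' α l = p := hp
        rw [hN', hN, hr, hp'] at hsub
        have hsub : (N' : ℤ) = N - (p - 1) * r := by exact_mod_cast hsub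
        have hq0 := (hq α).2
        zify at hr0 ⊢
        nlinarith
      obtain ⟨l', n', hne, hle, hbdd⟩ := ih N' hlt h' hN'
      exact ⟨l', n', hne, by omega, hbdd⟩
    · push Not at hex
      exact ⟨l, n, h, le_rfl, (isIntegralWeight_of_W_ne_bot h).coroot'_mem_Icc
        fun α p hp => (hex α p hp).trans (hM α)⟩

theorem exists_greatest_degree [Nonempty H.root] (hne : ∃ l n, ρ.W l n ≠ ⊥) :
    ∃ n, (∃ l, ρ.W l n ≠ ⊥) ∧ (∀ l n', n < n' → ρ.W l n' = ⊥) ∧ {l | ρ.W l n ≠ ⊥}.Finite := by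
  obtain ⟨M, hM⟩ : ∃ M, ∀ α, q α ≤ M := by
    obtain ⟨M, hM⟩ := (Set.finite_range q).bddAbove
    exact ⟨M, fun α => hM ⟨α, rfl⟩⟩
  have hfin := finite_setOf_coroot'_mem_Icc (P := rootSystem H) M
  obtain ⟨B, hB⟩ : ∃ B : ℤ, ∀ n, (∃ l, ρ.W l n ≠ ⊥) → n ≤ B := by
    choose N hN using hq.eventually_W_eq_bot
    obtain ⟨B, hB⟩ := (hfin.image N).bddAbove
    refine ⟨B, fun n ⟨l, hl⟩ => ?_⟩
    obtain ⟨l', n', hne', hnn', hbdd⟩ := hq.exists_W_ne_bot_coroot'_mem_Icc hM hl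
    have hlt : n' < N l' := not_le.mp fun hle => hne' (hN l' n' hle)
    exact hnn'.trans (hlt.le.trans (hB ⟨l', hbdd, rfl⟩))
  obtain ⟨n, hn, hmax⟩ := Int.exists_greatest_of_bdd (P := fun n => ∃ l, ρ.W l n ≠ ⊥) ⟨B, hB⟩
    (by obtain ⟨l, n, h⟩ := hne; exact ⟨n, l, h⟩)
  refine ⟨n, hn, fun l n' hlt => by_contra fun h => hlt.not_ge (hmax n' ⟨l, h⟩), ?_⟩
  refine hfin.subset fun l hl => (isIntegralWeight_of_W_ne_bot hl).coroot'_mem_Icc fun α p hp => ?_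
  refine le_trans (not_lt.mp fun hlt => ?_) (hM α)
  exact (lt_add_one n).not_ge (hmax _ ⟨_, hq.W_sub_root_ne_bot hl α hp hlt⟩)

end IsPositive

end AffRep

end AffineRepresentations

section RootSpaces

open LieAlgebra LieAlgebra.IsKilling LieModule

variable {K L : Type*} [Field K] [LieRing L] [LieAlgebra K L] [FiniteDimensional K L]
  {H : LieSubalgebra K L} [H.IsCartanSubalgebra] [IsTriangularizable K H L]

theorem map_mem_of_forall_rootSpace {M : Type*} [AddCommGroup M] [Module K M] (f : L →ₗ[K] M)
    {S : Submodule K M} (hH : ∀ y ∈ H, f y ∈ S)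
    (hroot : ∀ α : H.root, ∀ y ∈ rootSpace H α.1, f y ∈ S) (y : L) : f y ∈ S := by
  have hy : y ∈ ⨆ χ : Weight K H L, rootSpace H χ := by
    rw [iSup_genWeightSpace_eq_top' K H L]
    exact LieSubmodule.mem_top y
  refine LieSubmodule.iSup_induction _ (motive := fun y => f y ∈ S) hy (fun χ y hy => ?_)
    (by rw [map_zero]; exact S.zero_mem) fun y z hy hz => by rw [map_add]; exact S.add_mem hy hz
  by_cases hχ : χ.IsZero
  · rw [hχ, rootSpace_zero_eq] at hy
    exact hH y hy
  · exact hroot ⟨χ, by simpa using hχ⟩ y hy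

variable [CharZero K] [IsKilling K L]

theorem exists_root_apply_eq_height (b : (rootSystem H).Base) :
    ∃ h : H, ∀ α : H.root, α.1 h = (b.height α : K) := by
  let f : Module.Dual K (Module.Dual K H) := b.toWeightBasis.constr K fun _ => (1 : K)
  have hf : ∀ i ∈ b.support, f ((rootSystem H).root i) = 1 := fun i hi => by
    simpa only [b.toWeightBasis_apply] using
      b.toWeightBasis.constr_basis K (fun _ => (1 : K)) ⟨i, hi⟩
  refine ⟨(Module.evalEquiv K H).symm f, fun α => ?_⟩
  obtain ⟨g, -, -, hg⟩ := b.exists_root_eq_sum_int α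
  calc α.1 ((Module.evalEquiv K H).symm f)
      = f ((rootSystem H).root α) :=
        Module.apply_evalEquiv_symm_apply K H ((rootSystem H).root α) f
    _ = ∑ i ∈ b.support, (g i : K) := by
        rw [hg, map_sum]
        exact Finset.sum_congr rfl fun i hi => by rw [map_zsmul, hf i hi, zsmul_one]
    _ = b.height α := by rw [b.height_eq_sum hg, Int.cast_sum]

end RootSpaces

section Weights

open LieAlgebra LieAlgebra.IsKilling LieModule

variable {𝔤 : Type*} [LieRing 𝔤] [LieAlgebra ℂ 𝔤] {Φ : InvForm 𝔤} {H : LieSubalgebra ℂ 𝔤}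

/-- The weight `(h, k, r, e) ↦ l h + k k₁ + r r₁ + e e₁` of `𝔥 ⊕ ℂ K ⊕ ℂ d 0 ⊕ ℂ C`. -/
def mkWeight (l : Module.Dual ℂ H) (k₁ r₁ e₁ : ℂ) : Module.Dual ℂ (Cartan H) :=
  l.coprod ((LinearMap.toSpanSingleton ℂ ℂ k₁).coprod
    ((LinearMap.toSpanSingleton ℂ ℂ r₁).coprod (LinearMap.toSpanSingleton ℂ ℂ e₁)))

theorem mkWeight_apply (l : Module.Dual ℂ H) (k₁ r₁ e₁ : ℂ) (h : H) (k r e : ℂ) :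
    mkWeight l k₁ r₁ e₁ (h, k, r, e) = l h + (k * k₁ + (r * r₁ + e * e₁)) := rfl

theorem mkWeight_add (l l' : Module.Dual ℂ H) (k r e k' r' e' : ℂ) :
    mkWeight l k r e + mkWeight l' k' r' e' = mkWeight (l + l') (k + k') (r + r') (e + e') := by
  refine LinearMap.ext fun ⟨h, x, y, z⟩ => ?_
  simp only [LinearMap.add_apply, mkWeight_apply]
  ring

theorem exists_eq_mkWeight (μ : Module.Dual ℂ (Cartan H)) : ∃ l k r e, μ = mkWeight l k r e := by
  refine ⟨μ.comp (LinearMap.inl ℂ _ _), μ (0, 1, 0, 0), μ (0, 0, 1, 0), μ (0, 0, 0, 1),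
    LinearMap.ext fun ⟨h, k, r, e⟩ => ?_⟩
  simp only [mkWeight_apply, ← smul_eq_mul, ← map_smul, LinearMap.comp_apply, LinearMap.inl_apply,
    ← map_add]
  simp

variable (Φ H) in
/-- The weight space of `𝔏` of weight `η`, for the adjoint action. -/
def adWeightSpace (η : Module.Dual ℂ (Cartan H)) : Submodule ℂ (AffVir Φ) where
  carrier := {X | ∀ h : Cartan H, ⁅cartanIncl Φ H h, X⁆ = η h • X}
  add_mem' hX hY h := by rw [lie_add, hX h, hY h, smul_add]
  zero_mem' h := by rw [lie_zero, smul_zero]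
  smul_mem' t X hX h := by rw [lie_smul, hX h, smul_comm]

theorem K_mem_adWeightSpace : AffVir.K Φ ∈ adWeightSpace Φ H 0 := fun h => by
  rw [← lie_skew, AffVir.lie_K, neg_zero, LinearMap.zero_apply, zero_smul]

theorem C_mem_adWeightSpace : AffVir.C Φ ∈ adWeightSpace Φ H 0 := fun h => by
  rw [← lie_skew, AffVir.lie_C, neg_zero, LinearMap.zero_apply, zero_smul]

theorem d_mem_adWeightSpace (n : ℤ) : AffVir.d Φ n ∈ adWeightSpace Φ H (mkWeight 0 0 n 0) := by
  rintro ⟨h, k, r, e⟩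
  simp only [cartanIncl_apply, mkWeight_apply, add_lie, smul_lie, AffVir.lie_K, AffVir.lie_C,
    AffVir.lie_d_d]
  rw [← lie_skew, AffVir.lie_d_x]
  simp [smul_smul]

theorem x_mem_adWeightSpace [FiniteDimensional ℂ 𝔤] [H.IsCartanSubalgebra] [IsKilling ℂ 𝔤] (n : ℤ)
    {χ : Module.Dual ℂ H} {y : 𝔤} (hy : y ∈ rootSpace H χ) :
    AffVir.x Φ n y ∈ adWeightSpace Φ H (mkWeight χ 0 n 0) := by
  rintro ⟨h, k, r, e⟩
  have hhy : ⁅(h : 𝔤), y⁆ = χ h • y := lie_eq_smul_of_mem_rootSpace hy h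
  rw [cartanIncl_apply, mkWeight_apply, add_lie, add_lie, add_lie, smul_lie, smul_lie, smul_lie,
    AffVir.lie_K, AffVir.lie_C, AffVir.lie_d_x, AffVir.lie_x_x, hhy, map_smul]
  simp only [Int.cast_zero, zero_mul, ite_self, zero_smul, add_zero, zero_add, smul_zero, mul_zero,
    smul_smul, ← add_smul]

variable (Φ) in
/-- The subspace of `𝔏` spanned by the vectors on which `D` acts by a negative integer, for the
adjoint action. -/
noncomputable def negDegreePart (D : Cartan H) : Submodule ℂ (AffVir Φ) :=
  Submodule.span ℂ {X | ∃ j : ℕ, ⁅cartanIncl Φ H D, X⁆ = (-(j + 1 : ℂ)) • X}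

theorem mem_negDegreePart {D : Cartan H} {η : Module.Dual ℂ (Cartan H)} {X : AffVir Φ}
    (hX : X ∈ adWeightSpace Φ H η) {z : ℤ} (hz : z < 0) (hη : η D = z) :
    X ∈ negDegreePart Φ D := by
  obtain ⟨j, rfl⟩ : ∃ j : ℕ, z = -(j + 1 : ℤ) := ⟨(-z - 1).toNat, by omega⟩
  exact Submodule.subset_span ⟨j, by rw [hX D, hη]; push_cast; rfl⟩

theorem lie_cartanIncl [FiniteDimensional ℂ 𝔤] [H.IsCartanSubalgebra] [IsKilling ℂ 𝔤]
    (h h' : Cartan H) : ⁅cartanIncl Φ H h, cartanIncl Φ H h'⁆ = 0 := by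
  obtain ⟨h', k, r, e⟩ := h'
  have hx : AffVir.x Φ 0 h' ∈ adWeightSpace Φ H (mkWeight 0 0 (0 : ℤ) 0) :=
    x_mem_adWeightSpace 0 (toLieSubmodule_le_rootSpace_zero ℂ 𝔤 H h'.2)
  rw [cartanIncl_apply Φ H h' k r e, lie_add, lie_add, lie_add, lie_smul, lie_smul, lie_smul,
    K_mem_adWeightSpace h, C_mem_adWeightSpace h, hx h, d_mem_adWeightSpace 0 h]
  obtain ⟨h, k', r', e'⟩ := h
  simp [mkWeight_apply]

variable {A : Type*} [CommRing A] [Algebra ℂ A]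
  {V : Type*} [AddCommGroup V] [Module ℂ V] [LieRingModule (LA A Φ) V] [LieModule ℂ (LA A Φ) V]

theorem lie_mem_weightSpace {η μ : Module.Dual ℂ (Cartan H)} {X : AffVir Φ}
    (hX : X ∈ adWeightSpace Φ H η) (a : A) {v : V} (hv : v ∈ weightSpace A Φ H V μ) :
    ⁅(LA.tmul X a : LA A Φ), v⁆ ∈ weightSpace A Φ H V (μ + η) := fun h => by
  rw [leibniz_lie, LA.lie_tmul, hX h, one_mul, map_smul, LinearMap.smul_apply, smul_lie, hv h,
    lie_smul, ← add_smul, LinearMap.add_apply, add_comm]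

variable {l : Module.Dual ℂ H} {k r e : ℂ}

theorem lie_d_mem_weightSpace (n : ℤ) (a : A) {v : V}
    (hv : v ∈ weightSpace A Φ H V (mkWeight l k r e)) :
    ⁅(LA.tmul (AffVir.d Φ n) a : LA A Φ), v⁆ ∈ weightSpace A Φ H V (mkWeight l k (r + n) e) := by
  simpa only [mkWeight_add, add_zero] using lie_mem_weightSpace (d_mem_adWeightSpace n) a hv

theorem lie_x_mem_weightSpace [FiniteDimensional ℂ 𝔤] [H.IsCartanSubalgebra] [IsKilling ℂ 𝔤]
    (n : ℤ) {χ : Module.Dual ℂ H} {y : 𝔤} (hy : y ∈ rootSpace H χ) (a : A) {v : V}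
    (hv : v ∈ weightSpace A Φ H V (mkWeight l k r e)) :
    ⁅(LA.tmul (AffVir.x Φ n y) a : LA A Φ), v⁆ ∈
      weightSpace A Φ H V (mkWeight (l + χ) k (r + n) e) := by
  simpa only [mkWeight_add, add_zero] using lie_mem_weightSpace (x_mem_adWeightSpace n hy) a hv

theorem lie_K_of_mem_weightSpace {v : V} (hv : v ∈ weightSpace A Φ H V (mkWeight l k r e)) :
    ⁅(LA.tmul (AffVir.K Φ) 1 : LA A Φ), v⁆ = k • v := by
  simpa [cartanIncl_apply, mkWeight_apply] using hv (0, 1, 0, 0)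

theorem lie_x_zero_of_mem_weightSpace {v : V} (hv : v ∈ weightSpace A Φ H V (mkWeight l k r e))
    (h : H) : ⁅(LA.tmul (AffVir.x Φ 0 h) 1 : LA A Φ), v⁆ = l h • v := by
  simpa [cartanIncl_apply, mkWeight_apply] using hv (h, 0, 0, 0)

theorem exists_weightSpace_mkWeight_ne_bot (hV : IsWeightModule A Φ H V) [Nontrivial V] :
    ∃ l c r e, weightSpace A Φ H V (mkWeight l c r e) ≠ ⊥ := by
  by_contra! hbot
  refine bot_ne_top (α := Submodule ℂ V) ?_
  rw [← hV.2, eq_comm, iSup_eq_bot]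
  intro μ
  obtain ⟨l, c, r, e, rfl⟩ := exists_eq_mkWeight μ
  exact hbot l c r e

end Weights

section TriangularDecomposition

open LieAlgebra LieAlgebra.IsKilling LieModule

variable {𝔤 : Type*} [LieRing 𝔤] [LieAlgebra ℂ 𝔤] [IsKilling ℂ 𝔤] [FiniteDimensional ℂ 𝔤]
  (Φ : InvForm 𝔤) {H : LieSubalgebra ℂ 𝔤} [H.IsCartanSubalgebra] (b : (rootSystem H).Base)

/-- The positive or negative part of the triangular decomposition of `𝔏`, according to the sign `ε`,
which allows for treating highest and lowest weight modules simultaneously. -/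
noncomputable def nilradical (ε : ℤˣ) : Submodule ℂ (AffVir Φ) := Submodule.span ℂ
  ({X | ∃ α : H.root, 0 < ε * b.height α ∧ ∃ y ∈ rootSpace H α.1, X = AffVir.x Φ 0 y} ∪
    {X | ∃ n : ℤ, 0 < ε * n ∧ ∃ y : 𝔤, X = AffVir.x Φ n y} ∪
    {X | ∃ n : ℤ, 0 < ε * n ∧ X = AffVir.d Φ n})

theorem nilradical_one : nilradical Φ b 1 = posPart Φ b := by
  simp only [nilradical, posPart, Units.val_one, one_mul, RootPairing.Base.isPos_iff]

theorem nilradical_neg_one : nilradical Φ b (-1) = negPart Φ b := by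
  have hneg : ∀ α : H.root, ∃ β : H.root,
      b.height β = -b.height α ∧ (β.1 : H → ℂ) = -(α.1 : H → ℂ) := fun α =>
    ⟨(rootSystem H).reflectionPerm α α, b.height_reflectionPerm_self α, congrArg DFunLike.coe <|
      ((rootSystem H).root_reflectionPerm α α).trans ((rootSystem H).reflection_apply_self α)⟩
  have hroots : {X | ∃ α : H.root, b.height α < 0 ∧ ∃ y ∈ rootSpace H α.1, X = AffVir.x Φ 0 y} =
      {X | ∃ α : H.root, b.IsPos α ∧
        ∃ y ∈ rootSpace H (-(α.1 : H → ℂ)), X = AffVir.x Φ 0 y} := by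
    ext X
    constructor
    · rintro ⟨α, hα, y, hy, rfl⟩
      obtain ⟨β, hheight, hβ⟩ := hneg α
      exact ⟨β, b.isPos_iff.mpr (by omega), y, by rwa [hβ, neg_neg], rfl⟩
    · rintro ⟨α, hα, y, hy, rfl⟩
      obtain ⟨β, hheight, hβ⟩ := hneg α
      exact ⟨β, by rw [hheight]; exact neg_lt_zero.mpr hα, y, by rwa [hβ], rfl⟩
  simp only [nilradical, negPart, Units.val_neg, Units.val_one, neg_mul, one_mul,
    Left.neg_pos_iff, hroots]

variable {Φ b}

theorem x_zero_mem_nilradical {ε : ℤˣ} {α : H.root} (hα : 0 < ε * b.height α) {y : 𝔤}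
    (hy : y ∈ rootSpace H α.1) : AffVir.x Φ 0 y ∈ nilradical Φ b ε :=
  Submodule.subset_span <| Or.inl <| Or.inl ⟨α, hα, y, hy, rfl⟩

theorem x_mem_nilradical {ε : ℤˣ} {n : ℤ} (hn : 0 < ε * n) (y : 𝔤) :
    AffVir.x Φ n y ∈ nilradical Φ b ε :=
  Submodule.subset_span <| Or.inl <| Or.inr ⟨n, hn, y, rfl⟩

theorem d_mem_nilradical {ε : ℤˣ} {n : ℤ} (hn : 0 < ε * n) : AffVir.d Φ n ∈ nilradical Φ b ε :=
  Submodule.subset_span <| Or.inr ⟨n, hn, rfl⟩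

theorem nilradical_le {ε : ℤˣ} {S : Submodule ℂ (AffVir Φ)}
    (hx_zero : ∀ α : H.root, 0 < ε * b.height α → ∀ y ∈ rootSpace H α.1, AffVir.x Φ 0 y ∈ S)
    (hx_cartan : ∀ n : ℤ, 0 < ε * n → ∀ y ∈ H, AffVir.x Φ n y ∈ S)
    (hx_root : ∀ n : ℤ, 0 < ε * n → ∀ α : H.root, ∀ y ∈ rootSpace H α.1, AffVir.x Φ n y ∈ S)
    (hd : ∀ n : ℤ, 0 < ε * n → AffVir.d Φ n ∈ S) : nilradical Φ b ε ≤ S := by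
  refine Submodule.span_le.mpr ?_
  rintro _ ((⟨α, hα, y, hy, rfl⟩ | ⟨n, hn, y, rfl⟩) | ⟨n, hn, rfl⟩)
  · exact hx_zero α hα y hy
  · exact map_mem_of_forall_rootSpace (AffVir.x Φ n) (hx_cartan n hn) (hx_root n hn) y
  · exact hd n hn

variable (Φ b)

theorem nilradical_sup_range_cartanIncl (ε : ℤˣ) :
    nilradical Φ b (-ε) ⊔ (nilradical Φ b ε ⊔ LinearMap.range (cartanIncl Φ H)) = ⊤ := by
  suffices ∀ S, nilradical Φ b (-ε) ≤ S → nilradical Φ b ε ≤ S →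
      (∀ h, cartanIncl Φ H h ∈ S) → S = ⊤ from
    this _ le_sup_left (le_sup_left.trans le_sup_right) fun h =>
      Submodule.mem_sup_right <| Submodule.mem_sup_right ⟨h, rfl⟩
  intro S hneg hpos hT
  have hsign : ∀ n : ℤ, n ≠ 0 → 0 < (-ε : ℤˣ) * n ∨ 0 < ε * n := fun n hn => by
    rw [Units.val_neg, neg_mul, Left.neg_pos_iff]
    exact lt_or_gt_of_ne (mul_ne_zero ε.ne_zero hn)
  rw [eq_top_iff, ← AffVir.span_eq_top, Submodule.span_le]
  rintro _ ((⟨n, y, rfl⟩ | ⟨n, rfl⟩) | rfl | rfl)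
  · obtain rfl | hn := eq_or_ne n 0
    · refine map_mem_of_forall_rootSpace (H := H) (AffVir.x Φ 0)
        (fun y hy => by simpa [cartanIncl_apply] using hT (⟨y, hy⟩, 0, 0, 0))
        (fun α y hy => ?_) y
      obtain hα | hα := hsign _ (b.height_ne_zero α)
      exacts [hneg (x_zero_mem_nilradical hα hy), hpos (x_zero_mem_nilradical hα hy)]
    · obtain hn | hn := hsign n hn
      exacts [hneg (x_mem_nilradical hn y), hpos (x_mem_nilradical hn y)]
  · obtain rfl | hn := eq_or_ne n 0
    · simpa [cartanIncl_apply] using hT (0, 0, 1, 0)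
    · obtain hn | hn := hsign n hn
      exacts [hneg (d_mem_nilradical hn), hpos (d_mem_nilradical hn)]
  · simpa [cartanIncl_apply] using hT (0, 1, 0, 0)
  · simpa [cartanIncl_apply] using hT (0, 0, 0, 1)

theorem exists_nilradical_le_negDegreePart (ε : ℤˣ) :
    ∃ D : Cartan H, nilradical Φ b ε ≤ negDegreePart Φ D := by
  obtain ⟨r, hr⟩ := exists_root_apply_eq_height b
  obtain ⟨N, hN0, hN⟩ : ∃ N : ℤ, 0 < N ∧ ∀ α, |b.height α| < N := by
    obtain ⟨B, hB⟩ := (Set.finite_range fun α => |b.height α|).bddAbove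
    exact ⟨max B 0 + 1, by omega, fun α =>
      Int.lt_add_one_of_le ((hB ⟨α, rfl⟩).trans (le_max_left B 0))⟩
  have heval : ∀ (χ : Module.Dual ℂ H) (n p : ℤ), χ r = p →
      mkWeight χ 0 n 0 (-(ε : ℂ) • (r, 0, (N : ℂ), 0)) = ((-(ε * (p + N * n)) : ℤ) : ℂ) := by
    intro χ n p hp
    rw [map_smul, mkWeight_apply, hp, smul_eq_mul]
    push_cast
    ring
  have hneg : ∀ n p : ℤ, 0 < ε * n → |p| < N → -(ε * (p + N * n)) < 0 := by
    intro n p hn hp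
    rw [abs_lt] at hp
    obtain rfl | rfl := Int.units_eq_one_or ε
    · simp only [Units.val_one, one_mul] at hn ⊢
      nlinarith
    · simp only [Units.val_neg, Units.val_one, neg_mul, one_mul] at hn ⊢
      nlinarith
  refine ⟨-(ε : ℂ) • (r, 0, (N : ℂ), 0), nilradical_le (fun α hα y hy => ?_) (fun n hn y hy => ?_)
    (fun n hn α y hy => ?_) fun n hn => ?_⟩
  · refine mem_negDegreePart (x_mem_adWeightSpace (χ := α.1.toLinear) 0 hy) ?_ (heval _ 0 _ (hr α))
    rwa [mul_zero, add_zero, neg_lt_zero]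
  · have hy0 : y ∈ rootSpace H (0 : H → ℂ) := toLieSubmodule_le_rootSpace_zero ℂ 𝔤 H hy
    exact mem_negDegreePart (x_mem_adWeightSpace (χ := 0) n hy0) (hneg n 0 hn (by rwa [abs_zero]))
      (heval 0 n 0 (by simp))
  · exact mem_negDegreePart (x_mem_adWeightSpace (χ := α.1.toLinear) n hy)
      (hneg n _ hn (hN α)) (heval _ n _ (hr α))
  · exact mem_negDegreePart (d_mem_adWeightSpace n) (hneg n 0 hn (by rwa [abs_zero]))
      (heval 0 n 0 (by simp))

end TriangularDecomposition

section LoopAlgebra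

variable {𝔤 : Type*} [LieRing 𝔤] [LieAlgebra ℂ 𝔤] {Φ : InvForm 𝔤} {A : Type*} [CommRing A]
  [Algebra ℂ A]

theorem loopOf_le {P : Submodule ℂ (AffVir Φ)} {S : Submodule ℂ (LA A Φ)} :
    loopOf A P ≤ S ↔ ∀ X ∈ P, ∀ a, LA.tmul X a ∈ S := by
  refine Submodule.span_le.trans ⟨fun h X hX a => h ⟨X, hX, a, rfl⟩, ?_⟩
  rintro h _ ⟨X, hX, a, rfl⟩
  exact h X hX a

theorem loopOf_eq_map₂ (P : Submodule ℂ (AffVir Φ)) :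
    loopOf A P = Submodule.map₂ LA.tmul P ⊤ :=
  le_antisymm (loopOf_le.mpr fun _ hX _ => Submodule.apply_mem_map₂ _ hX Submodule.mem_top)
    (Submodule.map₂_le.mpr fun X hX a _ => Submodule.subset_span ⟨X, hX, a, rfl⟩)

theorem loopOf_sup (P Q : Submodule ℂ (AffVir Φ)) :
    loopOf A (P ⊔ Q) = loopOf A P ⊔ loopOf A Q := by
  rw [loopOf_eq_map₂, loopOf_eq_map₂, loopOf_eq_map₂, Submodule.map₂_sup_left]

theorem loopOf_top : loopOf A (⊤ : Submodule ℂ (AffVir Φ)) = ⊤ := by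
  rw [← LA.span_tmul, loopOf]
  simp only [Submodule.mem_top, true_and]

theorem lie_eq_zero_of_mem_loopOf {P Q : Submodule ℂ (AffVir Φ)}
    (h : ∀ X ∈ P, ∀ Y ∈ Q, ⁅X, Y⁆ = 0) {x y : LA A Φ} (hx : x ∈ loopOf A P) (hy : y ∈ loopOf A Q) :
    ⁅x, y⁆ = 0 := by
  induction hx, hy using Submodule.span_induction₂ with
  | mem_mem x y hx hy =>
    obtain ⟨X, hX, a, rfl⟩ := hx
    obtain ⟨Y, hY, a', rfl⟩ := hy
    rw [LA.lie_tmul, h X hX Y hY, map_zero, LinearMap.zero_apply]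
  | zero_left y _ => exact zero_lie y
  | zero_right x _ => exact lie_zero x
  | add_left x x' y _ _ _ hx hx' => rw [add_lie, hx, hx', add_zero]
  | add_right x y y' _ _ _ hy hy' => rw [lie_add, hy, hy', add_zero]
  | smul_left t x y _ _ h => rw [smul_lie, h, smul_zero]
  | smul_right t x y _ _ h => rw [lie_smul, h, smul_zero]

theorem lie_tmul_K (z : LA A Φ) : ⁅LA.tmul (AffVir.K Φ) (1 : A), z⁆ = 0 := by
  have hz : z ∈ loopOf A (⊤ : Submodule ℂ (AffVir Φ)) := by
    rw [loopOf_top]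
    exact Submodule.mem_top
  refine lie_eq_zero_of_mem_loopOf (P := ℂ ∙ AffVir.K Φ) (fun X hX Y _ => ?_)
    (Submodule.subset_span ⟨_, Submodule.mem_span_singleton_self _, 1, rfl⟩) hz
  obtain ⟨t, rfl⟩ := Submodule.mem_span_singleton.mp hX
  rw [smul_lie, AffVir.lie_K, smul_zero]

theorem lie_mem_of_mem_loopOf {V : Type*} [AddCommGroup V] [Module ℂ V] [LieRingModule (LA A Φ) V]
    [LieModule ℂ (LA A Φ) V] {P : Submodule ℂ (AffVir Φ)} {F : Submodule ℂ V} {v : V}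
    (h : ∀ X ∈ P, ∀ a : A, ⁅(LA.tmul X a : LA A Φ), v⁆ ∈ F) {z : LA A Φ} (hz : z ∈ loopOf A P) :
    ⁅z, v⁆ ∈ F :=
  loopOf_le (S := F.comap ((LieModule.toModuleHom ℂ (LA A Φ) V : LA A Φ ⊗[ℂ] V →ₗ[ℂ] V) ∘ₗ
    (TensorProduct.mk ℂ (LA A Φ) V).flip v)).mpr h hz

theorem loopOf_le_of_le_negDegreePart {H : LieSubalgebra ℂ 𝔤} {N : Submodule ℂ (AffVir Φ)}
    {D : Cartan H} (hN : N ≤ negDegreePart Φ D) :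
    loopOf A N ≤ Submodule.span ℂ {x : LA A Φ | ∃ j : ℕ,
      ⁅(LA.tmul (cartanIncl Φ H D) 1 : LA A Φ), x⁆ = -(j + 1 : ℂ) • x} := by
  refine loopOf_le.mpr fun X hX a => ?_
  suffices negDegreePart Φ D ≤ Submodule.comap (LA.tmul.flip a) (Submodule.span ℂ {x : LA A Φ |
      ∃ j : ℕ, ⁅(LA.tmul (cartanIncl Φ H D) 1 : LA A Φ), x⁆ = -(j + 1 : ℂ) • x}) from this (hN hX)
  refine Submodule.span_le.mpr ?_
  rintro Y ⟨j, hj⟩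
  refine Submodule.subset_span ⟨j, ?_⟩
  rw [LinearMap.flip_apply, LA.lie_tmul, hj, one_mul, map_smul, LinearMap.smul_apply]

end LoopAlgebra

section ExtremalVectors

open LieAlgebra LieAlgebra.IsKilling LieModule

variable {𝔤 : Type*} [LieRing 𝔤] [LieAlgebra ℂ 𝔤] [IsKilling ℂ 𝔤] [FiniteDimensional ℂ 𝔤]
  {Φ : InvForm 𝔤} {H : LieSubalgebra ℂ 𝔤} [H.IsCartanSubalgebra] {A : Type*} [CommRing A]
  [Algebra ℂ A] {V : Type*} [AddCommGroup V] [Module ℂ V] [LieRingModule (LA A Φ) V]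
  [LieModule ℂ (LA A Φ) V] {b : (rootSystem H).Base} {ε : ℤˣ}

theorem finrank_weightSpace_eq_one [IsIrreducible ℂ (LA A Φ) V] {μ : Module.Dual ℂ (Cartan H)}
    [FiniteDimensional ℂ (weightSpace A Φ H V μ)] (hμ : weightSpace A Φ H V μ ≠ ⊥)
    (hε : ∀ z ∈ loopOf A (nilradical Φ b ε), ∀ v ∈ weightSpace A Φ H V μ, ⁅z, v⁆ = 0) :
    Module.finrank ℂ (weightSpace A Φ H V μ) = 1 := by
  obtain ⟨D, hD⟩ := exists_nilradical_le_negDegreePart Φ b (-ε)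
  have hT : ∀ X ∈ LinearMap.range (cartanIncl Φ H), ∀ Y ∈ LinearMap.range (cartanIncl Φ H),
      ⁅X, Y⁆ = 0 := by
    rintro _ ⟨h, rfl⟩ _ ⟨h', rfl⟩
    exact lie_cartanIncl h h'
  refine finrank_eq_one_of_triangular (L := LA A Φ)
    (T := loopOf A (LinearMap.range (cartanIncl Φ H)))
    (by rw [← loopOf_sup, ← loopOf_sup, nilradical_sup_range_cartanIncl, loopOf_top])
    (loopOf_le_of_le_negDegreePart hD) (fun x hx y hy => lie_eq_zero_of_mem_loopOf hT hx hy) hμ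
    (fun v hv => Module.End.mem_eigenspace_iff.mpr (hv D)) hε
    fun z hz v hv => lie_mem_of_mem_loopOf ?_ hz
  rintro _ ⟨h, rfl⟩ a
  have hh : cartanIncl Φ H h ∈ adWeightSpace Φ H 0 := fun h' => by
    rw [lie_cartanIncl, LinearMap.zero_apply, zero_smul]
  simpa only [add_zero] using lie_mem_weightSpace hh a hv

variable {l : Module.Dual ℂ H} {c s e : ℂ}

theorem lie_eq_zero_of_mem_nilradical
    (hdegree : ∀ l' (k : ℤ), 0 < ε * k → weightSpace A Φ H V (mkWeight l' c (s + k) e) = ⊥)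
    (hheight : ∀ α : H.root, 0 < ε * b.height α →
      weightSpace A Φ H V (mkWeight (l + α.1.toLinear) c s e) = ⊥)
    {X : AffVir Φ} (hX : X ∈ nilradical Φ b ε) (a : A) {v : V}
    (hv : v ∈ weightSpace A Φ H V (mkWeight l c s e)) : ⁅(LA.tmul X a : LA A Φ), v⁆ = 0 := by
  let f : AffVir Φ →ₗ[ℂ] V := (toModuleHom ℂ (LA A Φ) V : LA A Φ ⊗[ℂ] V →ₗ[ℂ] V) ∘ₗ
    (TensorProduct.mk ℂ (LA A Φ) V).flip v ∘ₗ LA.tmul.flip a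
  refine nilradical_le (S := LinearMap.ker f) (fun α hα y hy => ?_) (fun n hn y hy => ?_)
    (fun n hn α y hy => ?_) (fun n hn => ?_) hX
  · have hmem := lie_x_mem_weightSpace 0 (χ := α.1.toLinear) hy a hv
    rwa [Int.cast_zero, add_zero, hheight α hα] at hmem
  · have hmem := lie_x_mem_weightSpace n (χ := 0) (toLieSubmodule_le_rootSpace_zero ℂ 𝔤 H hy) a hv
    rwa [hdegree _ n hn] at hmem
  · have hmem := lie_x_mem_weightSpace n (χ := α.1.toLinear) hy a hv
    rwa [hdegree _ n hn] at hmem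
  · have hmem := lie_d_mem_weightSpace n a hv
    rwa [hdegree _ n hn] at hmem

theorem exists_isGeneratedByExtremal [IsIrreducible ℂ (LA A Φ) V] (hV : IsIntegrable A Φ H V)
    (hne : ∃ l, weightSpace A Φ H V (mkWeight l c s e) ≠ ⊥)
    (hdegree : ∀ l (k : ℤ), 0 < ε * k → weightSpace A Φ H V (mkWeight l c (s + k) e) = ⊥)
    (hfin : {l | weightSpace A Φ H V (mkWeight l c s e) ≠ ⊥}.Finite) :
    ∃ μ, IsGeneratedByExtremal A Φ V H (loopOf A (nilradical Φ b ε)) μ ∧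
      Module.finrank ℂ (weightSpace A Φ H V μ) = 1 := by
  obtain ⟨r, hr⟩ := exists_root_apply_eq_height b
  obtain ⟨l, hl, hmax⟩ := Set.exists_max_image _ (fun l => ((ε : ℤ) : ℝ) * (l r).re) hfin hne
  have hheight : ∀ α : H.root, 0 < ε * b.height α →
      weightSpace A Φ H V (mkWeight (l + α.1.toLinear) c s e) = ⊥ := fun α hα => by
    by_contra h
    have hle := hmax (l + α.1.toLinear) h
    have hα' : (0 : ℝ) < (ε : ℤ) * b.height α := by exact_mod_cast hα
    have hre : ((α.1.toLinear : Module.Dual ℂ H) r).re = b.height α :=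
      (congrArg Complex.re (hr α)).trans (Complex.intCast_re _)
    rw [LinearMap.add_apply, Complex.add_re, hre] at hle
    linarith
  have hzero : ∀ z ∈ loopOf A (nilradical Φ b ε),
      ∀ v ∈ weightSpace A Φ H V (mkWeight l c s e), ⁅z, v⁆ = 0 := fun z hz v hv =>
    lie_mem_of_mem_loopOf (F := ⊥)
      (fun X hX a => lie_eq_zero_of_mem_nilradical hdegree hheight hX a hv) hz
  obtain ⟨v, hv, hv0⟩ := Submodule.exists_mem_ne_zero_of_ne_bot hl
  have := hV.finiteDimensional (mkWeight l c s e)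
  exact ⟨_, ⟨hV.isWeightModule, v, hv, hv0, fun z hz => hzero z hz v hv,
    exists_lift_toEnd_apply_eq hv0⟩, finrank_weightSpace_eq_one hl hzero⟩

end ExtremalVectors

section IntegrableModules

open LieAlgebra LieAlgebra.IsKilling LieModule

variable {𝔤 : Type*} [LieRing 𝔤] [LieAlgebra ℂ 𝔤] [IsKilling ℂ 𝔤] [FiniteDimensional ℂ 𝔤]
  {Φ : InvForm 𝔤} {H : LieSubalgebra ℂ 𝔤} [H.IsCartanSubalgebra] {A : Type*} [CommRing A]
  [Algebra ℂ A] {V : Type*} [AddCommGroup V] [Module ℂ V] [LieRingModule (LA A Φ) V]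
  [LieModule ℂ (LA A Φ) V]

attribute [local instance] LieRing.ofAssociativeRing LieAlgebra.ofAssociativeAlgebra

/-- An integrable module as a representation of the affine algebra `𝔤 ⊗ ℂ[t, t⁻¹] ⊕ ℂ K`, twisted
for `ε = -1` by the automorphism `t ↦ t⁻¹`, `K ↦ -K`. Only weights with given values `r` modulo `ℤ`
on `d 0` and `e` on `C` are taken into account. -/
noncomputable def IsIntegrable.affRep (hV : IsIntegrable A Φ H V) (ε : ℤˣ) {c : ℂ}
    (hc : ∀ v : V, ⁅(LA.tmul (AffVir.K Φ) 1 : LA A Φ), v⁆ = c • v) (r e : ℂ) : AffRep Φ H V where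
  X n := (toEnd ℂ (LA A Φ) V : LA A Φ →ₗ[ℂ] Module.End ℂ V) ∘ₗ LA.tmul.flip 1 ∘ₗ AffVir.x Φ (ε * n)
  level := ε * c
  W l n := weightSpace A Φ H V (mkWeight l c (r + (ε * n : ℤ)) e)
  lie_X n m y z := by
    have hiff : ((ε : ℤ) * m = -(ε * n)) ↔ m = -n := by
      rw [← mul_neg, mul_right_inj' ε.ne_zero]
    refine LinearMap.ext fun v => ?_
    simp only [LinearMap.comp_apply, LinearMap.flip_apply, LieHom.coe_toLinearMap, ← LieHom.map_lie,
      LA.lie_tmul, AffVir.lie_x_x, one_mul, hiff, map_add, map_smul, LinearMap.add_apply,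
      LinearMap.smul_apply, toEnd_apply_apply, hc, Module.End.one_apply, mul_add, smul_smul]
    split_ifs <;> push_cast <;> ring_nf
  X_zero_apply l n v hv h := by
    simpa using lie_x_zero_of_mem_weightSpace hv h
  X_apply_mem l n k χ y hy v hv := by
    have hmem := lie_x_mem_weightSpace (ε * k) hy (1 : A) hv
    rwa [add_assoc, ← Int.cast_add, ← mul_add] at hmem
  finiteDimensional_W l n := hV.finiteDimensional _
  exists_X_pow_apply_eq_zero χ hχ k y hy v :=
    hV.locallyNilpotent ⟨χ, by simpa using hχ⟩ (ε * k) y hy 1 v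

theorem IsIntegrable.exists_isGeneratedByExtremal_nilradical [Nonempty H.root]
    [IsIrreducible ℂ (LA A Φ) V] (hV : IsIntegrable A Φ H V) (b : (rootSystem H).Base) {c : ℂ}
    (hc : ∀ v : V, ⁅(LA.tmul (AffVir.K Φ) 1 : LA A Φ), v⁆ = c • v) {ε : ℤˣ} {q : H.root → ℤ}
    (hq : ∀ α : H.root, 0 < q α ∧
      c * Φ.form (coroot α.1) (coroot α.1) = 2 * ((ε * q α : ℤ) : ℂ)) :
    ∃ μ, IsGeneratedByExtremal A Φ V H (loopOf A (nilradical Φ b ε)) μ ∧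
      Module.finrank ℂ (weightSpace A Φ H V μ) = 1 := by
  have := LieModule.nontrivial_of_isIrreducible ℂ (LA A Φ) V
  obtain ⟨l, c', r, e, hne⟩ := exists_weightSpace_mkWeight_ne_bot hV.isWeightModule
  obtain rfl : c' = c := by
    obtain ⟨v, hv, hv0⟩ := Submodule.exists_mem_ne_zero_of_ne_bot hne
    exact smul_left_injective ℂ hv0 ((lie_K_of_mem_weightSpace hv).symm.trans (hc v))
  have hε : (ε : ℤ) * ε = 1 := congrArg Units.val (Int.units_mul_self ε)
  have hpos : (hV.affRep ε hc r e).IsPositive q := fun α => by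
    refine ⟨?_, (hq α).1⟩
    change ((ε : ℤ) : ℂ) * c' * _ = _
    rw [mul_assoc, (hq α).2, mul_left_comm, ← Int.cast_mul, ← mul_assoc, hε, one_mul]
  obtain ⟨n, hn, hmax, hfin⟩ := hpos.exists_greatest_degree
    ⟨l, 0, by simpa [affRep] using hne⟩
  refine exists_isGeneratedByExtremal hV hn (fun l' k hk => ?_) hfin
  have hW := hmax l' (n + ε * k) (by omega)
  change weightSpace A Φ H V (mkWeight l' c' (r + ((ε * (n + ε * k) : ℤ) : ℂ)) e) = ⊥ at hW
  rwa [mul_add, ← mul_assoc, hε, one_mul, Int.cast_add, ← add_assoc] at hW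

end IntegrableModules

section SimpleLieAlgebras

open LieAlgebra LieAlgebra.IsKilling LieModule

variable {𝔤 : Type*} [LieRing 𝔤] [LieAlgebra ℂ 𝔤] [FiniteDimensional ℂ 𝔤] [IsSimple ℂ 𝔤]
  {Φ : InvForm 𝔤} {H : LieSubalgebra ℂ 𝔤} [H.IsCartanSubalgebra] {A : Type*} [CommRing A]
  [Algebra ℂ A] {V : Type*} [AddCommGroup V] [Module ℂ V] [LieRingModule (LA A Φ) V]
  [LieModule ℂ (LA A Φ) V]

theorem IsIntegrable.exists_level_eq_unit_mul [IsIrreducible ℂ (LA A Φ) V]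
    (hV : IsIntegrable A Φ H V) (hK : ∃ v : V, ⁅(LA.tmul (AffVir.K Φ) 1 : LA A Φ), v⁆ ≠ 0) :
    ∃ c : ℂ, (∀ v : V, ⁅(LA.tmul (AffVir.K Φ) 1 : LA A Φ), v⁆ = c • v) ∧
      ∃ (ε : ℤˣ) (q : H.root → ℤ), ∀ α : H.root, 0 < q α ∧
        c * Φ.form (coroot α.1) (coroot α.1) = 2 * ((ε * q α : ℤ) : ℂ) := by
  have := LieModule.nontrivial_of_isIrreducible ℂ (LA A Φ) V
  obtain ⟨l, c, r, e, hne⟩ := exists_weightSpace_mkWeight_ne_bot hV.isWeightModule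
  obtain ⟨v, hv, hv0⟩ := Submodule.exists_mem_ne_zero_of_ne_bot hne
  have hc := lie_eq_smul_of_central lie_tmul_K hv0 (lie_K_of_mem_weightSpace hv)
  have hc0 : c ≠ 0 := by
    rintro rfl
    obtain ⟨w, hw⟩ := hK
    exact hw (by rw [hc, zero_smul])
  have := LieAlgebra.IsSimple.nontrivial ℂ 𝔤
  have hΦ : Φ.form ≠ 0 := Φ.nondegenerate.ne_zero
  refine ⟨c, hc, exists_sign_of_lieInvariant (H := H) (B := c • Φ.form) ?_
    (smul_ne_zero hc0 hΦ) fun α => ?_⟩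
  · exact fun x y z => (congrArg (c * ·) (Φ.invariant x y z)).trans (mul_neg _ _)
  · have hW : (hV.affRep 1 hc r e).W l 0 ≠ ⊥ := by simpa [affRep] using hne
    simpa [affRep] using AffRep.exists_int_level_mul_form hW α

end SimpleLieAlgebras

end LoopAffVir

theorem mainTheorem2_general {𝔤 : Type*} [LieRing 𝔤] [LieAlgebra ℂ 𝔤] [FiniteDimensional ℂ 𝔤]
    [LieAlgebra.IsSimple ℂ 𝔤] (Φ : InvForm 𝔤)
    (H : LieSubalgebra ℂ 𝔤) [H.IsCartanSubalgebra]
    (b : (LieAlgebra.IsKilling.rootSystem H).Base)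
    (A : Type*) [CommRing A] [Algebra ℂ A]
    (V : Type*) [AddCommGroup V] [Module ℂ V] [LieRingModule (LA A Φ) V] [LieModule ℂ (LA A Φ) V]
    [LieModule.IsIrreducible ℂ (LA A Φ) V] (hV : IsIntegrable A Φ H V)
    (hK : ∃ v : V, ⁅(LA.tmul (AffVir.K Φ) 1 : LA A Φ), v⁆ ≠ 0) :
    ((∃ μ, IsHighestWeightModule A Φ V b μ ∧ Module.finrank ℂ (weightSpace A Φ H V μ) = 1) ∨
      (∃ μ, IsLowestWeightModule A Φ V b μ ∧ Module.finrank ℂ (weightSpace A Φ H V μ) = 1)) ∧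
    (IsNormalized Φ b →
      ∃ m : ℤ, m ≠ 0 ∧ (∀ v : V, ⁅(LA.tmul (AffVir.K Φ) 1 : LA A Φ), v⁆ = (m : ℂ) • v) ∧
        (0 < m → ∃ μ, IsHighestWeightModule A Φ V b μ ∧
          Module.finrank ℂ (weightSpace A Φ H V μ) = 1) ∧
        (m < 0 → ∃ μ, IsLowestWeightModule A Φ V b μ ∧
          Module.finrank ℂ (weightSpace A Φ H V μ) = 1)) := by
  obtain ⟨c, hc, ε, q, hq⟩ := hV.exists_level_eq_unit_mul hK
  have := nonempty_root H
  have hextremal := hV.exists_isGeneratedByExtremal_nilradical b hc hq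
  have hlevel : IsNormalized Φ b → ∃ θ, c = ((ε * q θ : ℤ) : ℂ) := fun ⟨θ, _, hθ⟩ => by
    refine ⟨θ, mul_right_cancel₀ two_ne_zero ?_⟩
    rw [← hθ, (hq θ).2, hθ, mul_comm]
  obtain rfl | rfl := Int.units_eq_one_or ε
  · rw [nilradical_one] at hextremal
    refine ⟨Or.inl hextremal, fun hnorm => ?_⟩
    obtain ⟨θ, rfl⟩ := hlevel hnorm
    have hm : 0 < ((1 : ℤˣ) : ℤ) * q θ := by simpa using (hq θ).1
    exact ⟨_, hm.ne', hc, fun _ => hextremal, fun h => absurd h hm.not_gt⟩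
  · rw [nilradical_neg_one] at hextremal
    refine ⟨Or.inr hextremal, fun hnorm => ?_⟩
    obtain ⟨θ, rfl⟩ := hlevel hnorm
    have hm : ((-1 : ℤˣ) : ℤ) * q θ < 0 := by simpa using (hq θ).1
    exact ⟨_, hm.ne, hc, fun h => absurd h hm.not_gt, fun _ => hextremal⟩

theorem mainTheorem2 {𝔤 : Type*} [LieRing 𝔤] [LieAlgebra ℂ 𝔤] [FiniteDimensional ℂ 𝔤]
    [LieAlgebra.IsSimple ℂ 𝔤] (Φ : InvForm 𝔤)
    (H : LieSubalgebra ℂ 𝔤) [H.IsCartanSubalgebra]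
    (b : (LieAlgebra.IsKilling.rootSystem H).Base)
    (A : Type*) [CommRing A] [Algebra ℂ A] [Algebra.FiniteType ℂ A]
    (V : Type*) [AddCommGroup V] [Module ℂ V] [LieRingModule (LA A Φ) V] [LieModule ℂ (LA A Φ) V]
    [LieModule.IsIrreducible ℂ (LA A Φ) V] (hV : IsIntegrable A Φ H V)
    (hK : ∃ v : V, ⁅(LA.tmul (AffVir.K Φ) 1 : LA A Φ), v⁆ ≠ 0) :
    ((∃ μ, IsHighestWeightModule A Φ V b μ ∧ Module.finrank ℂ (weightSpace A Φ H V μ) = 1) ∨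
      (∃ μ, IsLowestWeightModule A Φ V b μ ∧ Module.finrank ℂ (weightSpace A Φ H V μ) = 1)) ∧
    (IsNormalized Φ b →
      ∃ m : ℤ, m ≠ 0 ∧ (∀ v : V, ⁅(LA.tmul (AffVir.K Φ) 1 : LA A Φ), v⁆ = (m : ℂ) • v) ∧
        (0 < m → ∃ μ, IsHighestWeightModule A Φ V b μ ∧
          Module.finrank ℂ (weightSpace A Φ H V μ) = 1) ∧
        (m < 0 → ∃ μ, IsLowestWeightModule A Φ V b μ ∧
          Module.finrank ℂ (weightSpace A Φ H V μ) = 1)) :=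
  mainTheorem2_general Φ H b A V hV hK
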